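/- Let $G=(V,E)$ be a finite simple graph with positive integer vertex weights $w\colon V\to\mathbb{Z}^{+}$, and write $w(X)=\sum_{v\in X}w(v)$. For $S\subseteq V$ put $\mathrm{cost}(S)=w(S)+\max_{C}w(V(C))$, where $C$ ranges over the connected components of $G-S$ (the maximum is $0$ if $S=V$), and let the weighted vertex integrity be $\mathrm{wvi}(G)=\min_{S\subseteq V}\mathrm{cost}(S)$. A set $S$ is optimal if $\mathrm{cost}(S)=\mathrm{wvi}(G)$. It is irredundant if for every $v\in S$ at least two connected components of $G-S$ contain neighbors of $v$. Vertices $u,v$ are twins if $N(u)\setminus\{v\}=N(v)\setminus\{u\}$; a twin class is a maximal nonempty set of pairwise twins; the neighborhood diversity $\mathrm{nd}(G)$ is the number of twin classes. (1) Binary Weighted Vertex Integrity (given $G$, $w$ and an integer $k$, with all numbers written in binary, decide whether $\mathrm{wvi}(G)\le k$) is fixed-parameter tractable parameterized by neighborhood diversity: there are a computable function $f\colon\mathbb{N}\to\mathbb{N}$, a constant $d$ and a single algorithm (a random access program under the logarithmic cost criterion) that decides every instance $x=(G,w,k)$ in time at most $f(\mathrm{nd}(G))\cdot|x|^{d}$,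 where $|x|$ is the binary input size. (2) For every finite graph $G$ with positive integer vertex weights, there is an optimal irredundant set $S\subseteq V$ that contains each twin class entirely or not at all (that is, $T\subseteq S$ or $T\cap S=\emptyset$ for every twin class $T$), and the number of subsets of $V$ that contain each twin class entirely or not at all is exactly $2^{\mathrm{nd}(G)}$. -/

import Mathlib

/-! ### Weighted vertex integrity, irredundant sets, twin classes, neighborhood diversity -/

namespace VertexIntegrity

variable {V : Type*}

open Classical in
/-- The total weight `w(X)` of a vertex set `X`. -/
noncomputable def weightOf [Fintype V] (w : V → ℕ+) (X : Set V) : ℕ :=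
  ∑ v ∈ Finset.univ.filter (fun v => v ∈ X), (w v : ℕ)

/-- The connected components of `G - S`. -/
abbrev Component (G : SimpleGraph V) (S : Set V) : Type _ :=
  (G.induce Sᶜ).ConnectedComponent

/-- The vertex set, as a set of vertices of `G`, of a connected component of `G - S`. -/
def compVerts {G : SimpleGraph V} {S : Set V} (C : Component G S) : Set V :=
  Subtype.val '' C.supp

/-- The maximum weight of a connected component of `G - S`
(a maximum over a finite set; it is `0` when `G - S` has no vertices). -/
noncomputable def maxCompWeight [Fintype V] (G : SimpleGraph V) (w : V → ℕ+) (S : Set V) : ℕ :=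
  ⨆ C : Component G S, weightOf w (compVerts C)

/-- `w(S) + max_{C ∈ cc(G - S)} w(V(C))`. -/
noncomputable def cost [Fintype V] (G : SimpleGraph V) (w : V → ℕ+) (S : Set V) : ℕ :=
  weightOf w S + maxCompWeight G w S

/-- The weighted vertex integrity of `(G, w)` (a minimum over the nonempty family of all `S`). -/
noncomputable def wvi [Fintype V] (G : SimpleGraph V) (w : V → ℕ+) : ℕ :=
  ⨅ S : Set V, cost G w S

/-- `S` is a `wvi(k)`-set. -/
def IsWviKSet [Fintype V] (G : SimpleGraph V) (w : V → ℕ+) (k : ℤ) (S : Set V) : Prop :=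
  (cost G w S : ℤ) ≤ k

/-- `S` is a `wvi`-set, i.e. an optimal set. -/
def IsWviSet [Fintype V] (G : SimpleGraph V) (w : V → ℕ+) (S : Set V) : Prop :=
  IsWviKSet G w (wvi G w : ℤ) S

/-- `v ∈ S` is redundant: at most one component of `G - S` contains neighbors of `v`. -/
def IsRedundant (G : SimpleGraph V) (S : Set V) (v : V) : Prop :=
  v ∈ S ∧ {C : Component G S | ∃ u ∈ compVerts C, G.Adj v u}.Subsingleton

/-- `S` contains no redundant vertices. -/
def IsIrredundant (G : SimpleGraph V) (S : Set V) : Prop :=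
  ∀ v ∈ S, ¬ IsRedundant G S v

/-- `N(u) \ {v} = N(v) \ {u}`. -/
def Twins (G : SimpleGraph V) (u v : V) : Prop :=
  G.neighborSet u \ {v} = G.neighborSet v \ {u}

/-- A twin class: a maximal (nonempty) set of pairwise twin vertices. -/
def IsTwinClass (G : SimpleGraph V) (T : Set V) : Prop :=
  Maximal (fun X : Set V => X.Nonempty ∧ ∀ u ∈ X, ∀ v ∈ X, Twins G u v) T

/-- The neighborhood diversity: the number of twin classes. -/
noncomputable def nd (G : SimpleGraph V) : ℕ :=
  {T : Set V | IsTwinClass G T}.ncard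

/-- `S` contains each twin class entirely or not at all. -/
def RespectsTwinClasses (G : SimpleGraph V) (S : Set V) : Prop :=
  ∀ T : Set V, IsTwinClass G T → T ⊆ S ∨ T ∩ S = ∅

end VertexIntegrity

/-! ### Random access programs with logarithmic cost

The memory consists of cells holding natural numbers; the cell `(a, i)` is the `i`-th cell of the
`a`-th array. A program mentions only finitely many arrays, while the index `i` is computed at run
time (indirect addressing). Every operation is charged the bit lengths of all numbers and
addresses involved in it (logarithmic cost criterion). -/

namespace RAM

/-- Arithmetic and comparison operations. -/
inductive Op where
  | add | sub | mul | div | lt | eq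

/-- Subtraction is truncated, division rounds down (and `x / 0 = 0`),
comparisons return `1` (true) or `0` (false). -/
def Op.eval : Op → ℕ → ℕ → ℕ
  | .add, x, y => x + y
  | .sub, x, y => x - y
  | .mul, x, y => x * y
  | .div, x, y => x / y
  | .lt, x, y => if x < y then 1 else 0
  | .eq, x, y => if x = y then 1 else 0

/-- Expressions: literals, the content of a memory cell, and operations. -/
inductive Exp where
  | lit (n : ℕ)
  | read (a : ℕ) (i : Exp)
  | op (o : Op) (e₁ e₂ : Exp)

/-- Programs. -/
inductive Prog where
  | skip
  | write (a : ℕ) (i e : Exp)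
  | seq (p q : Prog)
  | ite (e : Exp) (p q : Prog)
  | while (e : Exp) (p : Prog)

/-- The content of all memory cells. -/
abbrev Store : Type := ℕ → ℕ → ℕ

/-- The charge for handling the number `n`: one plus its binary length. -/
def bits (n : ℕ) : ℕ := 1 + Nat.size n

/-- Value of an expression. -/
def Exp.val (σ : Store) : Exp → ℕ
  | .lit n => n
  | .read a i => σ a (i.val σ)
  | .op o e₁ e₂ => o.eval (e₁.val σ) (e₂.val σ)

/-- Cost of evaluating an expression: every intermediate value is charged its bit length. -/
def Exp.cost (σ : Store) : Exp → ℕ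
  | .lit n => bits n
  | .read a i => i.cost σ + bits (σ a (i.val σ))
  | .op o e₁ e₂ => e₁.cost σ + e₂.cost σ + bits (o.eval (e₁.val σ) (e₂.val σ))

/-- Write the value `x` to the cell `(a, i)`. -/
def Store.set (σ : Store) (a i x : ℕ) : Store :=
  fun b j => if b = a ∧ j = i then x else σ b j

/-- `Run p σ τ t`: started on `σ`, the program `p` halts in memory state `τ`,
with total logarithmic cost `t`. -/
inductive Run : Prog → Store → Store → ℕ → Prop
  | skip (σ : Store) : Run .skip σ σ 1
  | write (a : ℕ) (i e : Exp) (σ : Store) :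
      Run (.write a i e) σ (σ.set a (i.val σ) (e.val σ)) (1 + i.cost σ + e.cost σ)
  | seq {p q : Prog} {σ τ ρ : Store} {s t : ℕ} :
      Run p σ τ s → Run q τ ρ t → Run (.seq p q) σ ρ (s + t)
  | ite_true {e : Exp} {p q : Prog} {σ τ : Store} {t : ℕ} :
      e.val σ ≠ 0 → Run p σ τ t → Run (.ite e p q) σ τ (1 + e.cost σ + t)
  | ite_false {e : Exp} {p q : Prog} {σ τ : Store} {t : ℕ} :
      e.val σ = 0 → Run q σ τ t → Run (.ite e p q) σ τ (1 + e.cost σ + t)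
  | while_true {e : Exp} {p : Prog} {σ τ ρ : Store} {s t : ℕ} :
      e.val σ ≠ 0 → Run p σ τ s → Run (.while e p) τ ρ t →
      Run (.while e p) σ ρ (1 + e.cost σ + s + t)
  | while_false {e : Exp} {p : Prog} {σ : Store} :
      e.val σ = 0 → Run (.while e p) σ σ (1 + e.cost σ)

/-- Initial memory: the input numbers stand in array `0`, everything else is `0`. -/
def initStore (l : List ℕ) : Store :=
  fun a i => if a = 0 then l.getD i 0 else 0

/-- The size of an input, with all numbers written in binary. -/
def inputSize (l : List ℕ) : ℕ := (l.map bits).sum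

/-- The problem `yes`, on instances `x : I` presented to the machine as `enc x`, is fixed-parameter
tractable for the parameterization `κ`: a single program decides it (with the answer in cell `0` of
array `1`) within time `f (κ x) * |x| ^ d`, where `f` is a computable function and `d` a constant. -/
def IsFPT {I : Type*} (enc : I → List ℕ) (κ : I → ℕ) (yes : I → Prop) : Prop :=
  ∃ (p : Prog) (f : ℕ → ℕ) (d : ℕ), Computable f ∧
    ∀ x : I, ∃ (τ : Store) (t : ℕ),
      Run p (initStore (enc x)) τ t ∧
      t ≤ f (κ x) * inputSize (enc x) ^ d ∧
      (yes x → τ 1 0 = 1) ∧ (¬ yes x → τ 1 0 = 0)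

end RAM

/-! ### The problem Binary Weighted Vertex Integrity -/

namespace VertexIntegrity

/-- An instance: a graph on the vertices `0, …, n - 1`, positive integer weights, an integer `k`. -/
structure Instance where
  n : ℕ
  G : SimpleGraph (Fin n)
  w : Fin n → ℕ+
  k : ℤ

open Classical in
/-- The input numbers: `n`, the sign and the absolute value of `k`, the `n` weights, and the rows of
the adjacency matrix of the graph. -/
noncomputable def Instance.encode (x : Instance) : List ℕ :=
  [x.n, if x.k < 0 then 1 else 0, x.k.natAbs]
    ++ List.ofFn (fun v => (x.w v : ℕ))
    ++ (List.ofFn fun u => List.ofFn fun v => if x.G.Adj u v then 1 else 0).flatten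

/-- The question: is `wvi(G) ≤ k`? -/
def Instance.IsYes (x : Instance) : Prop := (wvi x.G x.w : ℤ) ≤ x.k

/-- The parameter: the neighborhood diversity of the underlying graph. -/
noncomputable def Instance.ndParam (x : Instance) : ℕ := nd x.G

end VertexIntegrity

/-! The combinatorial core is that an inclusion-minimal optimal set is irredundant and that
irredundant sets are unions of twin classes. If `v ∈ S` is redundant, returning `v` to the graph
merges it with at most one component of `G - S`: the deleted weight drops by `w v`, and the largest
component grows by at most `w v`, so the cost does not increase (`IsRedundant.cost_diff_le`). If `u
∈ S` has a twin `v ∉ S`, all neighbors of `u` outside `S` lie in the component of `v`, so `u` is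
redundant (`IsIrredundant.respectsTwinClasses`). Unions of twin classes are the preimages of sets of
classes under the quotient by the twin relation, hence their number `2 ^ nd G`.

Consequently `wvi ≤ k` holds exactly when `k ≥ 0` and one of these `2 ^ nd G` unions has cost at
most `|k|` (`Instance.isYes_iff`). The program numbers the twin classes and lets a mask run through
all sets of classes. For each mask and each vertex it finds the component of that vertex by graph
search and compares the total weight with the budget. Each mask takes polynomial time. Logarithmic
costs are controlled by one bound `N`, linear in the input size, on the binary length of every
memory cell; a fixed expression then costs `O(N)`, and each loop over the vertices contributes one
more factor `N`. -/

namespace RAM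

/-! ### A calculus for running times of programs -/

/-- All memory cells hold numbers of at most `N` binary digits. -/
def Bdd (N : ℕ) (σ : Store) : Prop := ∀ a i, σ a i < 2 ^ N

/-- Started on `σ`, the program `p` halts within time `T` in an `N`-bounded state satisfying `Q`. -/
def Reaches (N T : ℕ) (p : Prog) (σ : Store) (Q : Store → Prop) : Prop :=
  ∃ τ t, Run p σ τ t ∧ t ≤ T ∧ Bdd N τ ∧ Q τ

/-- `τ` and `σ` agree outside of the arrays in `L`. -/
def Frame (L : List ℕ) (τ σ : Store) : Prop := ∀ b, b ∉ L → τ b = σ b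

/-- An exponent bounding the growth of the value of an expression. -/
def Exp.deg : Exp → ℕ
  | .lit n => n + 1
  | .read _ _ => 1
  | .op _ e₁ e₂ => e₁.deg + e₂.deg

/-- The factor in the linear bound for the cost of an expression. -/
def Exp.weight : Exp → ℕ
  | .lit n => n + 2
  | .read _ i => i.weight + 2
  | .op _ e₁ e₂ => e₁.weight + e₂.weight + e₁.deg + e₂.deg + 1

theorem Exp.one_le_deg (e : Exp) : 1 ≤ e.deg := by
  induction e <;> simp_all [Exp.deg]; omega

theorem Op.eval_lt (o : Op) {x y a b : ℕ} (ha : 1 ≤ a) (hb : 1 ≤ b)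
    (hx : x < 2 ^ a) (hy : y < 2 ^ b) : o.eval x y < 2 ^ (a + b) := by
  have h2a : 2 ≤ 2 ^ a := by simpa using Nat.pow_le_pow_right (n := 2) (by norm_num) ha
  have h2b : 2 ≤ 2 ^ b := by simpa using Nat.pow_le_pow_right (n := 2) (by norm_num) hb
  rw [pow_add]
  cases o <;> simp only [Op.eval]
  · nlinarith
  · have := Nat.sub_le x y; nlinarith
  · nlinarith
  · have := Nat.div_le_self x y; nlinarith
  · split <;> nlinarith
  · split <;> nlinarith

/-- Only memory cells are kept below `2 ^ N`; intermediate values may be longer, but by a factor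
depending on the expression alone. This makes evaluation linear in `N` in `Exp.cost_le`. -/
theorem Exp.val_lt {N : ℕ} (hN : 1 ≤ N) {σ : Store} (h : Bdd N σ) (e : Exp) :
    e.val σ < 2 ^ (N * e.deg) := by
  induction e with
  | lit n =>
    calc n < 2 ^ n := Nat.lt_two_pow_self
      _ ≤ _ := Nat.pow_le_pow_right (by norm_num) (by simp only [Exp.deg]; nlinarith)
  | read a i => simpa [Exp.val, Exp.deg] using h a _
  | op o e₁ e₂ h₁ h₂ =>
    simp only [Exp.val, Exp.deg, mul_add]
    exact o.eval_lt (Nat.mul_pos hN e₁.one_le_deg) (Nat.mul_pos hN e₂.one_le_deg) h₁ h₂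

theorem bits_le {x N : ℕ} (h : x < 2 ^ N) : bits x ≤ 1 + N := by
  have := Nat.size_le.2 h
  simp only [bits]; omega

theorem Exp.cost_le {N : ℕ} (hN : 1 ≤ N) {σ : Store} (h : Bdd N σ) (e : Exp) :
    e.cost σ ≤ N * e.weight := by
  induction e with
  | lit n =>
    have := bits_le (Exp.val_lt hN h (.lit n))
    simp only [Exp.val, Exp.deg] at this
    simp only [Exp.cost, Exp.weight]; nlinarith
  | read a i hi =>
    have := bits_le (h a (i.val σ))
    simp only [Exp.cost, Exp.weight]; nlinarith
  | op o e₁ e₂ h₁ h₂ =>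
    have := bits_le (Exp.val_lt hN h (.op o e₁ e₂))
    simp only [Exp.val, Exp.deg] at this
    simp only [Exp.cost, Exp.weight]; nlinarith

theorem Store.set_self (σ : Store) (a i x : ℕ) : σ.set a i x a i = x := by simp [Store.set]

theorem Store.set_apply (σ : Store) (a i x j : ℕ) :
    σ.set a i x a j = if j = i then x else σ a j := by simp [Store.set]

theorem Store.set_of_ne (σ : Store) {a b : ℕ} (h : b ≠ a) (i x : ℕ) : σ.set a i x b = σ b := by
  funext j; simp [Store.set, h]

theorem Bdd.set {N : ℕ} {σ : Store} (h : Bdd N σ) {x : ℕ} (hx : x < 2 ^ N) (a i : ℕ) :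
    Bdd N (σ.set a i x) := by
  intro b j
  simp only [Store.set]
  split
  · exact hx
  · exact h b j

theorem Frame.refl (L : List ℕ) (σ : Store) : Frame L σ σ := fun _ _ => rfl

theorem Frame.set {L : List ℕ} {τ σ : Store} (h : Frame L τ σ) {a : ℕ} (ha : a ∈ L) (i x : ℕ) :
    Frame L (τ.set a i x) σ := fun b hb => by
  rw [Store.set_of_ne _ (by rintro rfl; exact hb ha), h b hb]

theorem Frame.trans {L L' : List ℕ} {ρ τ σ : Store} (h : Frame L ρ τ) (hL : L ⊆ L')
    (h' : Frame L' τ σ) : Frame L' ρ σ := fun b hb => by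
  rw [h b (fun hm => hb (hL hm)), h' b hb]

theorem Reaches.mono {N T T' : ℕ} {p : Prog} {σ : Store} {Q Q' : Store → Prop}
    (h : Reaches N T p σ Q) (hT : T ≤ T') (hQ : ∀ τ, Bdd N τ → Q τ → Q' τ) :
    Reaches N T' p σ Q' := by
  obtain ⟨τ, t, hr, ht, hb, hq⟩ := h
  exact ⟨τ, t, hr, ht.trans hT, hb, hQ τ hb hq⟩

theorem Reaches.skip {N : ℕ} (hN : 1 ≤ N) {σ : Store} (h : Bdd N σ) {Q : Store → Prop} (hQ : Q σ) :
    Reaches N N .skip σ Q := ⟨σ, 1, .skip σ, hN, h, hQ⟩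

theorem Reaches.write {N : ℕ} (hN : 1 ≤ N) {σ : Store} (h : Bdd N σ) {Q : Store → Prop} {a : ℕ}
    {i e : Exp} {j x : ℕ} (hj : i.val σ = j) (hx : e.val σ = x) (hlt : x < 2 ^ N)
    (hQ : Q (σ.set a j x)) :
    Reaches N (N * (1 + i.weight + e.weight)) (.write a i e) σ Q := by
  subst hj hx
  refine ⟨_, _, .write a i e σ, ?_, h.set hlt _ _, hQ⟩
  have h₁ := i.cost_le hN h
  have h₂ := e.cost_le hN h
  nlinarith

theorem Reaches.seq {N T₁ T₂ : ℕ} {σ : Store} {p q : Prog} {Q R : Store → Prop}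
    (h₁ : Reaches N T₁ p σ Q) (h₂ : ∀ τ, Bdd N τ → Q τ → Reaches N T₂ q τ R) :
    Reaches N (T₁ + T₂) (.seq p q) σ R := by
  obtain ⟨τ, s, hr, hs, hb, hq⟩ := h₁
  obtain ⟨ρ, t, hr', ht, hb', hq'⟩ := h₂ τ hb hq
  exact ⟨ρ, s + t, .seq hr hr', Nat.add_le_add hs ht, hb', hq'⟩

theorem Reaches.ite {N T₁ T₂ : ℕ} (hN : 1 ≤ N) {σ : Store} (h : Bdd N σ) {e : Exp} {p q : Prog}
    {Q : Store → Prop} (h₁ : e.val σ ≠ 0 → Reaches N T₁ p σ Q)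
    (h₂ : e.val σ = 0 → Reaches N T₂ q σ Q) :
    Reaches N (N * (1 + e.weight) + T₁ + T₂) (.ite e p q) σ Q := by
  have hc := e.cost_le hN h
  by_cases he : e.val σ = 0
  · obtain ⟨τ, t, hr, ht, hb, hq⟩ := h₂ he
    exact ⟨τ, _, .ite_false he hr, by nlinarith, hb, hq⟩
  · obtain ⟨τ, t, hr, ht, hb, hq⟩ := h₁ he
    exact ⟨τ, _, .ite_true he hr, by nlinarith, hb, hq⟩

/-- The content of cell `0` of array `c`. -/
abbrev Exp.var (c : ℕ) : Exp := .read c (.lit 0)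

/-- Run `p` with the counter `c` (cell `0` of array `c`) ranging over all numbers below `e`. -/
def Prog.for (c : ℕ) (e : Exp) (p : Prog) : Prog :=
  .seq (.write c (.lit 0) (.lit 0)) (.while (.op .lt (.var c) e)
    (.seq p (.write c (.lit 0) (.op .add (.var c) (.lit 1)))))

/-- `Inv i` describes the state in which the counter already holds `i`, so the body must establish
`Inv (i + 1)` for its final state with the counter advanced. The bound `e` is evaluated again in
every round and therefore has to keep the value `m` under the invariant. -/
theorem Reaches.for {N T m c : ℕ} {e : Exp} {p : Prog} {σ : Store} (Inv : ℕ → Store → Prop)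
    (hN : 1 ≤ N) (hσ : Bdd N σ) (hm : m < 2 ^ N) (h0 : Inv 0 (σ.set c 0 0))
    (he : ∀ i τ, Inv i τ → e.val τ = m)
    (hp : ∀ i τ, i < m → Bdd N τ → τ c 0 = i → Inv i τ →
      Reaches N T p τ (fun ρ => ρ c 0 = i ∧ Inv (i + 1) (ρ.set c 0 (i + 1)))) :
    Reaches N ((m + 1) * (T + N * (e.weight + 30))) (.for c e p) σ (Inv m) := by
  -- Induction on the number `j` of rounds still to come.
  have key : ∀ j i τ, i + j = m → Bdd N τ → τ c 0 = i → Inv i τ →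
      Reaches N (j * (T + N * (e.weight + 24)) + N * (e.weight + 12))
        (.while (.op .lt (.var c) e) (.seq p (.write c (.lit 0) (.op .add (.var c) (.lit 1)))))
        τ (Inv m) := by
    intro j
    induction j with
    | zero =>
      intro i τ hi hb hc hI
      refine ⟨τ, _, .while_false ?_, ?_, hb, by simpa [← hi] using hI⟩
      · simp only [Exp.val, Op.eval, he i τ hI, hc]
        simp; omega
      · have h₁ := (Exp.cost_le hN hb (.var c))
        have h₂ := (Exp.cost_le hN hb e)
        simp only [Exp.cost, Op.eval] at h₁ ⊢
        simp only [Exp.weight] at h₁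
        have h₃ : bits (if Exp.val τ (.var c) < Exp.val τ e then 1 else 0) ≤ 1 + 1 :=
          bits_le (by split <;> norm_num)
        nlinarith
    | succ j ih =>
      intro i τ hi hb hc hI
      obtain ⟨ρ, t, hr, ht, hb', hc', hI'⟩ := hp i τ (by omega) hb hc hI
      have hw : Reaches N (N * 14) (.write c (.lit 0) (.op .add (.var c) (.lit 1))) ρ
          (fun ρ' => ρ' = ρ.set c 0 (i + 1)) :=
        (Reaches.write (Q := fun ρ' => ρ' = ρ.set c 0 (i + 1)) hN hb' (j := 0) (x := i + 1) rfl
          (by simp [Exp.val, Op.eval, hc']) (by omega) rfl).mono (by simp [Exp.weight, Exp.deg]) (fun _ _ h => h)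
      obtain ⟨ρ', t', hr', ht', hb'', rfl⟩ := hw
      obtain ⟨ω, t'', hr'', ht'', hb₃, hq⟩ :=
        ih (i + 1) _ (by omega) hb'' (by simp [Store.set]) hI'
      refine ⟨ω, _, .while_true ?_ (.seq hr hr') hr'', ?_, hb₃, hq⟩
      · simp only [Exp.val, Op.eval, he i τ hI, hc]
        rw [if_pos (by omega)]; norm_num
      · have h₁ := (Exp.cost_le hN hb (.var c))
        have h₂ := (Exp.cost_le hN hb e)
        simp only [Exp.cost, Op.eval] at h₁ ⊢
        simp only [Exp.weight] at h₁
        have h₃ : bits (if Exp.val τ (.var c) < Exp.val τ e then 1 else 0) ≤ 1 + 1 :=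
          bits_le (by split <;> norm_num)
        have h₄ : (j + 1) * (T + N * (e.weight + 24)) =
          j * (T + N * (e.weight + 24)) + (T + N * (e.weight + 24)) := by ring
        rw [h₄]
        nlinarith
  have h1 : Reaches N (N * 5) (.write c (.lit 0) (.lit 0)) σ (fun ρ => ρ = σ.set c 0 0) :=
    (Reaches.write (Q := fun ρ => ρ = σ.set c 0 0) hN hσ (j := 0) (x := 0) rfl rfl (by positivity) rfl).mono
      (by simp [Exp.weight]) (fun _ _ h => h)
  refine (h1.seq (T₂ := m * (T + N * (e.weight + 24)) + N * (e.weight + 12)) ?_).mono ?_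
    (fun _ _ h => h)
  · rintro τ hb rfl
    exact key m 0 _ (by omega) hb (by simp [Store.set]) h0
  · have : m * (T + N * (e.weight + 24)) ≤ m * (T + N * (e.weight + 30)) := by gcongr; omega
    nlinarith

end RAM

/-! ### Polynomial time bounds, bits, and the twin test -/

namespace RAM

/-- A loop over the vertices raises the exponent of `N` by one. The constants stay explicit
numerals, so the comparisons with the rounded bounds below are settled by `decide`. -/
theorem loop_time {n N T C w j : ℕ} (hn : n + 1 ≤ N) (hT : T ≤ C * N ^ (j + 1)) :
    (n + 1) * (T + N * w) ≤ (C + w) * N ^ (j + 2) := by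
  have h1 : N ≤ N ^ (j + 1) := Nat.le_self_pow (by omega) N
  calc (n + 1) * (T + N * w) ≤ N * (C * N ^ (j + 1) + N ^ (j + 1) * w) := by gcongr
    _ = _ := by ring

theorem le_mul_pow (N : ℕ) {C : ℕ} (j : ℕ) : N * C ≤ C * N ^ (j + 1) := by
  rw [mul_comm]; gcongr; exact Nat.le_self_pow (by omega) N

theorem pow_mul_le {N : ℕ} (hN : 1 ≤ N) {C i j : ℕ} (h : i ≤ j) : C * N ^ i ≤ C * N ^ j :=
  Nat.mul_le_mul_left _ (Nat.pow_le_pow_right hN h)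

theorem one_lt_two_pow' {N : ℕ} (hN : 1 ≤ N) : 1 < 2 ^ N := Nat.one_lt_two_pow (by omega)

/-- Boolean values. -/
def IsBit (x : ℕ) (p : Prop) : Prop := x < 2 ∧ (x ≠ 0 ↔ p)

theorem IsBit.of_iff {x : ℕ} {p q : Prop} (h : IsBit x p) (hpq : p ↔ q) : IsBit x q :=
  ⟨h.1, h.2.trans hpq⟩

theorem IsBit.lt {x N : ℕ} {p : Prop} (h : IsBit x p) (hN : 1 ≤ N) : x < 2 ^ N :=
  lt_of_lt_of_le h.1 (by simpa using Nat.pow_le_pow_right (n := 2) (by norm_num) hN)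

theorem isBit_ite (p : Prop) [Decidable p] : IsBit (if p then 1 else 0) p := by
  unfold IsBit; split <;> simp_all

theorem IsBit.and {x y : ℕ} {p q : Prop} (h : IsBit x p) (h' : IsBit y q) :
    IsBit (x * y) (p ∧ q) := by
  obtain ⟨h1, h2⟩ := h
  obtain ⟨h3, h4⟩ := h'
  refine ⟨?_, by rw [← h2, ← h4]; exact mul_ne_zero_iff⟩
  interval_cases x <;> omega

theorem IsBit.not {x : ℕ} {p : Prop} (h : IsBit x p) : IsBit (1 - x) (¬ p) := by
  obtain ⟨h1, h2⟩ := h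
  exact ⟨by omega, by rw [← h2]; omega⟩

theorem isBit_mod (x : ℕ) : IsBit (x % 2) (x % 2 = 1) := ⟨Nat.mod_lt _ (by norm_num), by omega⟩

/-- `a[c]` for a variable `c`. -/
abbrev Exp.cell (a c : ℕ) : Exp := .read a (.var c)

/-- The number of vertices. -/
abbrev Exp.order : Exp := .read 0 (.lit 0)

/-- The entry `(u, v)` of the adjacency matrix. -/
def Exp.adj (u v : ℕ) : Exp :=
  .read 0 (.op .add (.op .add (.lit 3) .order) (.op .add (.op .mul (.var u) .order) (.var v)))

/-- The weight of `v`. -/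
def Exp.wt (v : ℕ) : Exp := .read 0 (.op .add (.lit 3) (.var v))

/-- Whether the class of `v` is selected by the current mask. -/
def Exp.mem (v : ℕ) : Exp :=
  .op .sub (.op .div (.var 8) (.cell 6 v))
    (.op .mul (.lit 2) (.op .div (.op .div (.var 8) (.cell 6 v)) (.lit 2)))

/-- The adjacency entry `(u, v)` of the input `I`. -/
def adjOf (I : ℕ → ℕ) (u v : ℕ) : ℕ := I (3 + I 0 + (u * I 0 + v))

/-- Membership of `v` in the set described by the mask. -/
def memOf (σ : Store) (v : ℕ) : ℕ := σ 8 0 / σ 6 v % 2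

@[simp] theorem Exp.val_lit (σ : Store) (n : ℕ) : (Exp.lit n).val σ = n := rfl

@[simp] theorem Exp.val_read (σ : Store) (a : ℕ) (i : Exp) :
    (Exp.read a i).val σ = σ a (i.val σ) := rfl

@[simp] theorem Exp.val_op (σ : Store) (o : Op) (e e' : Exp) :
    (Exp.op o e e').val σ = o.eval (e.val σ) (e'.val σ) := rfl

@[simp] theorem Exp.val_adj (σ : Store) (u v : ℕ) :
    (Exp.adj u v).val σ = adjOf (σ 0) (σ u 0) (σ v 0) := by
  simp [Exp.adj, adjOf, Op.eval]

@[simp] theorem Exp.val_wt (σ : Store) (v : ℕ) : (Exp.wt v).val σ = σ 0 (3 + σ v 0) := by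
  simp [Exp.wt, Op.eval]

@[simp] theorem Exp.val_mem (σ : Store) (v : ℕ) : (Exp.mem v).val σ = memOf σ (σ v 0) := by
  -- Parity is computed as `q - 2 * (q / 2)`. Array `6` holds `2 ^ i` for a vertex of class `i`, so
  -- the parity of the quotient is bit `i` of the mask.
  simp only [Exp.mem, memOf, val_op, val_read, val_lit, Op.eval]; omega

/-- `u` and `v` have the same adjacency to all `z < j` other than `u` and `v`. -/
def Agree (I : ℕ → ℕ) (u v j : ℕ) : Prop :=
  ∀ z < j, z ≠ u → z ≠ v → adjOf I u z = adjOf I v z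

/-- Put into cell `0` of array `5` whether the vertices `u`, `v` in arrays `3`, `2` are twins. -/
def Prog.twinTest : Prog :=
  .seq (.write 5 (.lit 0) (.lit 1)) (.for 4 .order (.write 5 (.lit 0) (.op .mul (.var 5)
    (.op .lt (.lit 0) (.op .add (.op .add (.op .eq (.var 4) (.var 3)) (.op .eq (.var 4) (.var 2)))
      (.op .eq (.adj 3 4) (.adj 2 4)))))))

theorem twinTest_reaches {N : ℕ} {σ : Store} (hσ : Bdd N σ) (hn : σ 0 0 + 1 ≤ N) :
    Reaches N (300 * N ^ 2) .twinTest σ (fun τ => Frame [4, 5] τ σ ∧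
      IsBit (τ 5 0) (Agree (σ 0) (σ 3 0) (σ 2 0) (σ 0 0))) := by
  have hN : 1 ≤ N := by omega
  have h1 : Reaches N (N * 6) (.write 5 (.lit 0) (.lit 1)) σ (fun τ => τ = σ.set 5 0 1) :=
    .write hN hσ rfl rfl (one_lt_two_pow' hN) rfl
  refine Reaches.mono (h1.seq (T₂ := 250 * N ^ 2) ?_) ?_ (fun _ _ h => h)
  · rintro τ hτ rfl
    refine Reaches.mono (Reaches.for (m := σ 0 0) (T := 200 * N ^ 1)
      (fun j τ => Frame [4, 5] τ σ ∧ IsBit (τ 5 0) (Agree (σ 0) (σ 3 0) (σ 2 0) j))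
      hN hτ (hσ _ _) ?_ ?_ ?_) ?_ (fun _ _ h => h)
    · refine ⟨((Frame.refl _ _).set (by simp) _ _).set (by simp) _ _, ?_⟩
      simp [Store.set, IsBit, Agree]
    · rintro i τ ⟨hf, -⟩
      simp [hf 0 (by simp)]
    · rintro i τ hi hb hc ⟨hf, hbit⟩
      -- Conjunction of bits is a product; disjunction is positivity of a sum. The two equality
      -- tests exempt the vertices `u` and `v` themselves.
      have hbit' : IsBit _ (Agree (σ 0) (σ 3 0) (σ 2 0) (i + 1)) :=
        (hbit.and (isBit_ite (0 < (if i = σ 3 0 then 1 else 0) + (if i = σ 2 0 then 1 else 0) +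
          if adjOf (σ 0) (σ 3 0) i = adjOf (σ 0) (σ 2 0) i then 1 else 0))).of_iff <| by
          unfold Agree
          constructor
          · rintro ⟨h, h'⟩ z hz hz1 hz2
            rcases Nat.lt_succ_iff_lt_or_eq.1 hz with hz | rfl
            · exact h z hz hz1 hz2
            · by_contra hne
              simp [hz1, hz2, hne] at h'
          · refine fun h => ⟨fun z hz => h z (by omega), ?_⟩
            by_cases h1 : i = σ 3 0
            · rw [if_pos h1]; omega
            · by_cases h2 : i = σ 2 0
              · rw [if_pos h2]; omega
              · rw [if_pos (h i (by omega) h1 h2)]; omega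
      refine Reaches.mono (.write hN hb (j := 0) rfl ?_ (hbit'.lt hN)
        (Q := fun ρ => ρ 4 0 = i ∧ Frame [4, 5] (ρ.set 4 0 (i + 1)) σ ∧
          IsBit (ρ.set 4 0 (i + 1) 5 0) (Agree (σ 0) (σ 3 0) (σ 2 0) (i + 1))) ?_) ?_
          (fun _ _ h => h)
      · simp [Op.eval, hc, hf 0, hf 3, hf 2]
      · refine ⟨by simp [Store.set, hc], (hf.set (by simp) _ _).set (by simp) _ _, ?_⟩
        simpa [Store.set] using hbit'
      · refine (le_mul_pow N 0).trans ?_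
        gcongr; decide
    · refine (loop_time hn le_rfl).trans ?_
      gcongr; decide
  · have := le_mul_pow N (C := 6) 1
    nlinarith

end RAM

/-! ### Numbering the twin classes -/

namespace RAM

/-- Search for a twin of the vertex `v` (in array `2`) among the preceding vertices, and copy its
entry of array `6`. -/
def Prog.findTwin : Prog :=
  .for 3 (.var 2) (.seq .twinTest (.write 6 (.var 2) (.op .add (.op .mul (.var 5) (.cell 6 3))
    (.op .mul (.op .sub (.lit 1) (.var 5)) (.cell 6 2)))))

-- The value `0` encodes "no twin found"; it cannot be confused with a label, since labels are
-- powers of two. The scan does not stop at a twin, so the last one found determines the entry.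
open Classical in
theorem findTwin_reaches {N : ℕ} {σ : Store} (hσ : Bdd N σ) (hn : σ 0 0 + 1 ≤ N)
    (hv : σ 2 0 < σ 0 0) (h0 : σ 6 (σ 2 0) = 0) :
    Reaches N (500 * N ^ 3) .findTwin σ (fun τ => Frame [3, 4, 5, 6] τ σ ∧
      (∀ x, x ≠ σ 2 0 → τ 6 x = σ 6 x) ∧
      (τ 6 (σ 2 0) = 0 ∧ (∀ u < σ 2 0, ¬ Agree (σ 0) u (σ 2 0) (σ 0 0)) ∨
        ∃ u < σ 2 0, Agree (σ 0) u (σ 2 0) (σ 0 0) ∧ τ 6 (σ 2 0) = σ 6 u)) := by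
  have hN : 1 ≤ N := by omega
  refine Reaches.mono (Reaches.for (m := σ 2 0) (T := 400 * N ^ 2)
    (fun j τ => Frame [3, 4, 5, 6] τ σ ∧ (∀ x, x ≠ σ 2 0 → τ 6 x = σ 6 x) ∧
      (τ 6 (σ 2 0) = 0 ∧ (∀ u < j, ¬ Agree (σ 0) u (σ 2 0) (σ 0 0)) ∨
        ∃ u < j, Agree (σ 0) u (σ 2 0) (σ 0 0) ∧ τ 6 (σ 2 0) = σ 6 u))
    hN hσ (hσ _ _) ?_ ?_ ?_) ?_ (fun _ _ h => h)
  · exact ⟨(Frame.refl _ _).set (by simp) _ _, by simp [Store.set], by simp [Store.set, h0]⟩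
  · rintro i τ ⟨hf, -⟩
    simp [hf 2 (by simp)]
  · rintro j τ hj hb hc ⟨hf, hP, hcase⟩
    have e0 : τ 0 = σ 0 := hf 0 (by simp)
    have e2 : τ 2 = σ 2 := hf 2 (by simp)
    refine Reaches.mono ((twinTest_reaches hb (by rwa [e0])).seq (T₂ := 100 * N ^ 1) ?_) ?_
      (fun _ _ h => h)
    · rintro ρ hb' ⟨hf', hlt, hbit⟩
      rw [e0, e2, hc] at hbit
      have r0 : ρ 0 = σ 0 := (hf' 0 (by simp)).trans e0
      have r2 : ρ 2 = σ 2 := (hf' 2 (by simp)).trans e2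
      have r3 : ρ 3 0 = j := (congrFun (hf' 3 (by simp)) 0).trans hc
      have r6 : ρ 6 = τ 6 := hf' 6 (by simp)
      -- The expression `b * x + (1 - b) * y` is a choice between `x` and `y` without branching.
      have hval : ρ 5 0 * ρ 6 j + (1 - ρ 5 0) * ρ 6 (σ 2 0) =
          if Agree (σ 0) j (σ 2 0) (σ 0 0) then σ 6 j else τ 6 (σ 2 0) := by
        rw [r6, hP j (by omega)]
        split
        · have : ρ 5 0 = 1 := by have := hbit.2 ‹_›; omega
          simp [this]
        · have : ρ 5 0 = 0 := by by_contra h; exact ‹¬ _› (hbit.1 h)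
          simp [this]
      refine Reaches.mono (.write hN hb' (j := σ 2 0) (x := ρ 5 0 * ρ 6 j + (1 - ρ 5 0) *
        ρ 6 (σ 2 0)) (by simp [r2]) ?_ ?_ (Q := fun ω => ω 3 0 = j ∧
          Frame [3, 4, 5, 6] (ω.set 3 0 (j + 1)) σ ∧
          (∀ x, x ≠ σ 2 0 → ω.set 3 0 (j + 1) 6 x = σ 6 x) ∧
          (ω.set 3 0 (j + 1) 6 (σ 2 0) = 0 ∧ (∀ u < j + 1, ¬ Agree (σ 0) u (σ 2 0) (σ 0 0)) ∨
            ∃ u < j + 1, Agree (σ 0) u (σ 2 0) (σ 0 0) ∧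
              ω.set 3 0 (j + 1) 6 (σ 2 0) = σ 6 u)) ?_) ?_ (fun _ _ h => h)
      · simp [Op.eval, r2, r3]
      · rw [hval]
        split
        · exact hσ _ _
        · exact hb _ _
      · refine ⟨by simp [Store.set, r3], ?_, ?_, ?_⟩
        · exact ((hf'.trans (by simp) hf).set (by simp) _ _).set (by simp) _ _
        · intro x hx
          simpa [Store.set, hx, r6] using hP x hx
        · rw [hval]
          simp only [Store.set_of_ne _ (show 6 ≠ 3 by norm_num), Store.set_self]
          split
          · exact .inr ⟨j, by omega, ‹_›, rfl⟩
          · rcases hcase with ⟨h, h'⟩ | ⟨u, hu, h, h'⟩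
            · refine .inl ⟨h, fun u hu => ?_⟩
              rcases Nat.lt_succ_iff_lt_or_eq.1 hu with hu | rfl
              · exact h' u hu
              · assumption
            · exact .inr ⟨u, by omega, h, h'⟩
      · refine (le_mul_pow N 0).trans ?_
        gcongr; decide
    · have := pow_mul_le hN (C := 100) (show 1 ≤ 2 by norm_num)
      nlinarith
  · refine (loop_time (by omega) le_rfl).trans ?_
    gcongr; decide

/-- The vertices below `v` are sorted into `m` twin classes: the number of the class of `u` is
the exponent of the power of two `P u`. -/
def Classes (I P : ℕ → ℕ) (v m : ℕ) : Prop :=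
  ∃ c : ℕ → ℕ, (∀ u < v, P u = 2 ^ c u ∧ c u < m) ∧
    (∀ u < v, ∀ u' < v, c u = c u' ↔ Agree I u u' (I 0)) ∧ ∀ i < m, ∃ u < v, c u = i

theorem Agree.symm {I : ℕ → ℕ} {u v j : ℕ} (h : Agree I u v j) : Agree I v u j :=
  fun z hz h1 h2 => (h z hz h2 h1).symm

theorem Agree.refl (I : ℕ → ℕ) (u j : ℕ) : Agree I u u j := fun _ _ _ _ => rfl

/-- Every class has a representative below `v`. This keeps the label `2 ^ m` within `N` binary
digits. -/
theorem Classes.le {I P : ℕ → ℕ} {v m : ℕ} (h : Classes I P v m) : m ≤ v := by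
  obtain ⟨c, -, -, h⟩ := h
  have : Finset.range m ⊆ (Finset.range v).image c := fun i hi => by
    obtain ⟨u, hu, rfl⟩ := h i (Finset.mem_range.1 hi)
    exact Finset.mem_image_of_mem _ (Finset.mem_range.2 hu)
  simpa using (Finset.card_le_card this).trans Finset.card_image_le

theorem Classes.congr {I P Q : ℕ → ℕ} {v m : ℕ} (h : Classes I P v m)
    (hPQ : ∀ u < v, Q u = P u) : Classes I Q v m := by
  obtain ⟨c, h1, h2⟩ := h
  exact ⟨c, fun u hu => by rw [hPQ u hu]; exact h1 u hu, h2⟩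

/-- Transitivity of `Agree` is a hypothesis because it rests on the symmetry of the adjacency
matrix, which an arbitrary input array need not have. -/
theorem Classes.succ_of_agree {I P : ℕ → ℕ} {v m : ℕ}
    (ht : ∀ u ≤ v, ∀ u' ≤ v, ∀ u'' ≤ v, Agree I u u' (I 0) → Agree I u' u'' (I 0) →
      Agree I u u'' (I 0))
    (h : Classes I P v m) {u : ℕ} (hu : u < v) (hA : Agree I u v (I 0)) (hP : P v = P u) :
    Classes I P (v + 1) m := by
  obtain ⟨c, h1, h2, h3⟩ := h
  have key : ∀ x < v, c x = c u ↔ Agree I x v (I 0) := fun x hx => by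
    rw [h2 x hx u hu]
    exact ⟨fun h => ht x hx.le u hu.le v le_rfl h hA,
      fun h => ht x hx.le v le_rfl u hu.le h hA.symm⟩
  refine ⟨fun x => if x = v then c u else c x, fun x hx => ?_, fun x hx y hy => ?_,
    fun i hi => ?_⟩
  · by_cases hxv : x = v
    · subst hxv; simpa [hP] using h1 u hu
    · simpa [hxv] using h1 x (by omega)
  · by_cases hxv : x = v <;> by_cases hyv : y = v
    · simp [hxv, hyv, Agree.refl]
    · simp only [hxv, hyv, if_true, if_false]
      rw [eq_comm, key y (by omega)]
      exact ⟨Agree.symm, Agree.symm⟩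
    · simp only [hxv, hyv, if_true, if_false]
      exact key x (by omega)
    · simp only [hxv, hyv, if_false]
      exact h2 x (by omega) y (by omega)
  · obtain ⟨x, hx, rfl⟩ := h3 i hi
    exact ⟨x, by omega, if_neg (by omega)⟩

theorem Classes.succ_of_new {I P : ℕ → ℕ} {v m : ℕ} (h : Classes I P v m)
    (hA : ∀ u < v, ¬ Agree I u v (I 0)) (hP : P v = 2 ^ m) : Classes I P (v + 1) (m + 1) := by
  obtain ⟨c, h1, h2, h3⟩ := h
  refine ⟨fun x => if x = v then m else c x, fun x hx => ?_, fun x hx y hy => ?_,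
    fun i hi => ?_⟩
  · by_cases hxv : x = v
    · subst hxv; simp [hP]
    · have := h1 x (by omega)
      simpa [hxv] using ⟨this.1, by omega⟩
  · by_cases hxv : x = v <;> by_cases hyv : y = v
    · simp [hxv, hyv, Agree.refl]
    · have := h1 y (by omega)
      simp only [hxv, hyv, if_true, if_false]
      exact ⟨fun h => by omega, fun h => absurd h.symm (hA y (by omega))⟩
    · have := h1 x (by omega)
      simp only [hxv, hyv, if_true, if_false]
      exact ⟨fun h => by omega, fun h => absurd h (hA x (by omega))⟩
    · simp only [hxv, hyv, if_false]
      exact h2 x (by omega) y (by omega)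
  · rcases Nat.lt_succ_iff_lt_or_eq.1 hi with hi | rfl
    · obtain ⟨x, hx, rfl⟩ := h3 i hi
      exact ⟨x, by omega, if_neg (by omega)⟩
    · exact ⟨v, by omega, if_pos rfl⟩

/-- Number the twin classes: array `6` contains the powers of two given by the numbers of the
classes, and cell `0` of array `7` the power of two given by the number of classes. -/
def Prog.classes : Prog :=
  .seq (.write 7 (.lit 0) (.lit 1)) (.for 2 .order (.seq (.write 6 (.var 2) (.lit 0))
    (.seq .findTwin (.ite (.cell 6 2) .skip
      (.seq (.write 6 (.var 2) (.var 7)) (.write 7 (.lit 0) (.op .mul (.var 7) (.lit 2))))))))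

theorem classes_reaches {N : ℕ} {σ : Store} (hσ : Bdd N σ) (hn : σ 0 0 + 1 ≤ N)
    (ht : ∀ u < σ 0 0, ∀ v < σ 0 0, ∀ w < σ 0 0, Agree (σ 0) u v (σ 0 0) →
      Agree (σ 0) v w (σ 0 0) → Agree (σ 0) u w (σ 0 0)) :
    Reaches N (1000 * N ^ 4) .classes σ (fun τ => Frame [2, 3, 4, 5, 6, 7] τ σ ∧
      ∃ m, τ 7 0 = 2 ^ m ∧ Classes (σ 0) (τ 6) (σ 0 0) m) := by
  have hN : 1 ≤ N := by omega
  have h1 : Reaches N (N * 6) (.write 7 (.lit 0) (.lit 1)) σ (fun τ => τ = σ.set 7 0 1) :=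
    .write hN hσ rfl rfl (one_lt_two_pow' hN) rfl
  refine Reaches.mono (h1.seq (T₂ := 900 * N ^ 4) ?_) ?_ (fun _ _ h => h)
  swap
  · have : N * 6 ≤ 6 * N ^ 4 := le_mul_pow N 3
    linarith
  rintro τ hτ rfl
  refine Reaches.mono (Reaches.for (m := σ 0 0) (T := 800 * N ^ 3)
    (fun v τ => Frame [2, 3, 4, 5, 6, 7] τ σ ∧
      ∃ m, τ 7 0 = 2 ^ m ∧ Classes (σ 0) (τ 6) v m)
    hN hτ (hσ _ _) ?_ ?_ ?_) ?_ (fun _ _ h => h)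
  · exact ⟨((Frame.refl _ _).set (by simp) _ _).set (by simp) _ _, 0, by simp [Store.set], id,
      by simp, by simp, by simp⟩
  · rintro i τ ⟨hf, -⟩
    simp [hf 0 (by simp)]
  · rintro v τ hv hb hc ⟨hf, m, hM, hcl⟩
    have hmv := hcl.le
    have hm2 : 2 ^ m * 2 < 2 ^ N := by
      rw [← pow_succ]; exact Nat.pow_lt_pow_right (by norm_num) (by omega)
    have h2 : Reaches N (N * 7) (.write 6 (.var 2) (.lit 0)) τ (fun ρ => ρ = τ.set 6 v 0) :=
      .write hN hb (by simp [hc]) rfl (by positivity) rfl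
    refine Reaches.mono (h2.seq (T₂ := 700 * N ^ 3) ?_) ?_ (fun _ _ h => h)
    swap
    · have : N * 7 ≤ 7 * N ^ 3 := le_mul_pow N 2
      linarith
    rintro ρ hρ rfl
    have r0 : (τ.set 6 v 0) 0 = σ 0 := (Store.set_of_ne _ (by norm_num) _ _).trans (hf 0 (by simp))
    have r2 : (τ.set 6 v 0) 2 0 = v := by simpa [Store.set] using hc
    refine Reaches.mono ((findTwin_reaches hρ (by rwa [r0]) (by rw [r0, r2]; exact hv)
      (by rw [r2]; simp [Store.set])).seq (T₂ := 100 * N ^ 1) ?_) ?_ (fun _ _ h => h)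
    swap
    · have := pow_mul_le hN (C := 100) (show 1 ≤ 3 by norm_num)
      nlinarith
    rintro ω hω ⟨hf', hP, hcase⟩
    rw [r0, r2] at hcase
    rw [r2] at hP
    have w2 : ω 2 0 = v := (congrFun (hf' 2 (by simp)) 0).trans r2
    have w7 : ω 7 0 = 2 ^ m :=
      (congrFun (hf' 7 (by simp)) 0).trans ((by simp [Store.set] : _ = τ 7 0).trans hM)
    have hfω : Frame [2, 3, 4, 5, 6, 7] ω σ := hf'.trans (by simp) (hf.set (by simp) _ _)
    have hPω : ∀ u < v, ω 6 u = τ 6 u := fun u hu => by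
      rw [hP u (by omega)]; simp [Store.set]; omega
    have htv : ∀ u ≤ v, ∀ u' ≤ v, ∀ u'' ≤ v, Agree (σ 0) u u' (σ 0 0) →
        Agree (σ 0) u' u'' (σ 0 0) → Agree (σ 0) u u'' (σ 0 0) :=
      fun u hu u' hu' u'' hu'' => ht u (by omega) u' (by omega) u'' (by omega)
    have hpos : ∀ u < v, τ 6 u ≠ 0 := by
      obtain ⟨c, h, -⟩ := hcl
      intro u hu
      rw [(h u hu).1]
      positivity
    have hcl' := hcl.congr hPω
    refine Reaches.mono (Reaches.ite hN hω
      (Q := fun ρ => ρ 2 0 = v ∧ Frame [2, 3, 4, 5, 6, 7] (ρ.set 2 0 (v + 1)) σ ∧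
        ∃ m, ρ.set 2 0 (v + 1) 7 0 = 2 ^ m ∧
          Classes (σ 0) (ρ.set 2 0 (v + 1) 6) (v + 1) m)
      (T₁ := N) (T₂ := N * 12 + N * 30) (fun h => ?_) (fun h => ?_)) ?_ (fun _ _ h => h)
    · refine Reaches.skip hN hω ⟨w2, hfω.set (by simp) _ _, m, by simpa [Store.set] using w7, ?_⟩
      simp only [Exp.val_read, Exp.val_lit, w2] at h
      obtain ⟨u, hu, hA, he⟩ := hcase.resolve_left (fun h' => h h'.1)
      refine Classes.succ_of_agree htv hcl' hu hA ?_
      simp only [Store.set_of_ne _ (show 6 ≠ 2 by norm_num)]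
      rw [he, hPω u hu]
      simp [Store.set]; omega
    · simp only [Exp.val_read, Exp.val_lit, w2] at h
      have hnew : ∀ u < v, ¬ Agree (σ 0) u v (σ 0 0) := by
        rcases hcase with h' | ⟨u, hu, -, he⟩
        · exact h'.2
        · refine absurd ?_ (hpos u hu)
          rw [← h, he]
          simp [Store.set]; omega
      have h3 : Reaches N (N * 12) (.write 6 (.var 2) (.var 7)) ω
          (fun ρ => ρ = ω.set 6 v (2 ^ m)) :=
        (Reaches.write hN hω (j := v) (x := 2 ^ m) (by simp [w2]) (by simp [w7]) (by omega)
          (Q := fun ρ => ρ = ω.set 6 v (2 ^ m)) rfl).mono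
          (Nat.mul_le_mul_left _ (by decide)) (fun _ _ h => h)
      refine h3.seq ?_
      rintro ρ hρ rfl
      refine Reaches.mono (.write hN hρ (j := 0) (x := 2 ^ m * 2) rfl
        (by simp [Op.eval, Store.set, w7]) hm2
        (Q := fun ρ => ρ 2 0 = v ∧ Frame [2, 3, 4, 5, 6, 7] (ρ.set 2 0 (v + 1)) σ ∧
        ∃ m, ρ.set 2 0 (v + 1) 7 0 = 2 ^ m ∧
          Classes (σ 0) (ρ.set 2 0 (v + 1) 6) (v + 1) m) ?_)
        (Nat.mul_le_mul_left _ (by decide)) (fun _ _ h => h)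
      refine ⟨by simpa [Store.set] using w2,
        ((hfω.set (by simp) _ _).set (by simp) _ _).set (by simp) _ _, m + 1,
        by simp [Store.set, pow_succ], ?_⟩
      refine Classes.succ_of_new (hcl'.congr fun u hu => ?_) hnew ?_
      · simp [Store.set]; omega
      · simp [Store.set]
    · simp [Exp.weight]; omega
  · refine (loop_time hn le_rfl).trans ?_
    gcongr; decide

end RAM

/-! ### Graph search outside the selected set, and weight sums -/

namespace RAM

/-- `b` is reached from `v` by a walk of length at most `i` that avoids `S` (given by its
indicator function). -/
def Within (I S : ℕ → ℕ) (v : ℕ) : ℕ → ℕ → Prop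
  | 0, b => b = v ∧ S b = 0
  | i + 1, b => Within I S v i b ∨ ∃ a < I 0, Within I S v i a ∧ adjOf I a b ≠ 0 ∧ S b = 0

/-- The indicator function `X` of a subset of the numbers below `n` lies between `A` and `B`. -/
def Between (n : ℕ) (X : ℕ → ℕ) (A B : ℕ → Prop) : Prop :=
  ∀ b < n, X b < 2 ∧ (A b → X b ≠ 0) ∧ (X b ≠ 0 → B b)

theorem Between.mono {n : ℕ} {X : ℕ → ℕ} {A A' B : ℕ → Prop} (h : Between n X A B)
    (hA : ∀ b < n, A' b → A b) : Between n X A' B :=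
  fun b hb => ⟨(h b hb).1, fun ha => (h b hb).2.1 (hA b hb ha), (h b hb).2.2⟩

theorem memOf_congr {σ τ : Store} (h8 : τ 8 = σ 8) (h6 : τ 6 = σ 6) : memOf τ = memOf σ := by
  funext x; simp [memOf, h8, h6]

/-- Add the neighbors of the vertex in array `3` to the set in array `9` if it contains it. -/
def Prog.addNeighbors : Prog :=
  .for 12 .order (.write 9 (.var 12) (.op .lt (.lit 0) (.op .add (.cell 9 12)
    (.op .mul (.op .mul (.cell 9 3) (.adj 3 12)) (.op .sub (.lit 1) (.mem 12))))))

/-- The set in array `9` is updated in place, so a vertex added during a round may itself be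
expanded in that round, and the set need not be a ball of exact radius. It is therefore only
enclosed: the lower bound `A` gains one step, while the upper bound `B` is any set closed under
steps avoiding the mask. -/
theorem addNeighbors_reaches {N : ℕ} {σ : Store} (hσ : Bdd N σ) (hn : σ 0 0 + 1 ≤ N)
    {A B : ℕ → Prop} (ha : σ 3 0 < σ 0 0) (hX : Between (σ 0 0) (σ 9) A B)
    (hB : ∀ a < σ 0 0, ∀ b, B a → adjOf (σ 0) a b ≠ 0 → memOf σ b = 0 → B b) :
    Reaches N (500 * N ^ 2) .addNeighbors σ (fun τ => Frame [9, 12] τ σ ∧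
      Between (σ 0 0) (τ 9)
        (fun b => A b ∨ A (σ 3 0) ∧ adjOf (σ 0) (σ 3 0) b ≠ 0 ∧ memOf σ b = 0) B) := by
  have hN : 1 ≤ N := by omega
  refine Reaches.mono (Reaches.for (m := σ 0 0) (T := 400 * N ^ 1)
    (fun j τ => Frame [9, 12] τ σ ∧ Between (σ 0 0) (τ 9) (fun b => A b ∨
      b < j ∧ A (σ 3 0) ∧ adjOf (σ 0) (σ 3 0) b ≠ 0 ∧ memOf σ b = 0) B)
    hN hσ (hσ _ _) ?_ ?_ ?_) ?_ ?_
  · refine ⟨(Frame.refl _ _).set (by simp) _ _, ?_⟩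
    rw [Store.set_of_ne _ (by norm_num)]
    exact hX.mono (by simp)
  · rintro i τ ⟨hf, -⟩
    simp [hf 0 (by simp)]
  · rintro j τ hj hb hc ⟨hf, hXj⟩
    have e0 : τ 0 = σ 0 := hf 0 (by simp)
    have e3 : τ 3 = σ 3 := hf 3 (by simp)
    have em : memOf τ = memOf σ := memOf_congr (hf 8 (by simp)) (hf 6 (by simp))
    have hbit := isBit_ite (0 < τ 9 j + τ 9 (σ 3 0) * adjOf (σ 0) (σ 3 0) j * (1 - memOf σ j))
    refine Reaches.mono (.write hN hb (j := j) (by simp [hc]) ?_ (hbit.lt hN)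
      (Q := fun ρ => ρ 12 0 = j ∧ Frame [9, 12] (ρ.set 12 0 (j + 1)) σ ∧
        Between (σ 0 0) (ρ.set 12 0 (j + 1) 9) (fun b => A b ∨
          b < j + 1 ∧ A (σ 3 0) ∧ adjOf (σ 0) (σ 3 0) b ≠ 0 ∧ memOf σ b = 0) B) ?_) ?_
          (fun _ _ h => h)
    · simp [Op.eval, hc, e0, e3, em]
    · refine ⟨by simp [Store.set, hc], (hf.set (by simp) _ _).set (by simp) _ _, ?_⟩
      rw [Store.set_of_ne _ (by norm_num)]
      intro b hbn
      rw [Store.set_apply]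
      by_cases hbj : b = j
      · subst hbj
        rw [if_pos rfl]
        refine ⟨hbit.1, fun h => hbit.2.2 ?_, fun h => ?_⟩
        · rcases h with h | ⟨-, h1, h2, h3⟩
          · have := (hXj b hbn).2.1 (.inl h); omega
          · have := (hXj _ ha).2.1 (.inl h1)
            simp only [h3]
            positivity
        · have h := hbit.2.1 h
          by_cases h9 : τ 9 b = 0
          · simp only [h9, zero_add, Nat.pos_iff_ne_zero, mul_ne_zero_iff] at h
            exact hB _ ha b ((hXj _ ha).2.2 h.1.1) h.1.2 (by omega)
          · exact (hXj b hbn).2.2 h9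
      · rw [if_neg hbj]
        obtain ⟨h1, h2, h3⟩ := hXj b hbn
        refine ⟨h1, fun h => h2 ?_, h3⟩
        rcases h with h | ⟨h, h'⟩
        · exact .inl h
        · exact .inr ⟨by omega, h'⟩
    · refine (le_mul_pow N 0).trans ?_
      gcongr; decide
  · refine (loop_time hn le_rfl).trans ?_
    gcongr; decide
  · rintro τ - ⟨hf, h⟩
    refine ⟨hf, h.mono fun b hb h' => h'.imp_right fun h'' => ⟨hb, h''⟩⟩

/-- Add all neighbors of the set in array `9` to it. -/
def Prog.expand : Prog := .for 3 .order .addNeighbors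

theorem expand_reaches {N : ℕ} {σ : Store} (hσ : Bdd N σ) (hn : σ 0 0 + 1 ≤ N)
    {A B : ℕ → Prop} (hX : Between (σ 0 0) (σ 9) A B)
    (hB : ∀ a < σ 0 0, ∀ b, B a → adjOf (σ 0) a b ≠ 0 → memOf σ b = 0 → B b) :
    Reaches N (600 * N ^ 3) .expand σ (fun τ => Frame [3, 9, 12] τ σ ∧
      Between (σ 0 0) (τ 9)
        (fun b => A b ∨ ∃ a < σ 0 0, A a ∧ adjOf (σ 0) a b ≠ 0 ∧ memOf σ b = 0) B) := by
  have hN : 1 ≤ N := by omega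
  refine Reaches.mono (Reaches.for (m := σ 0 0) (T := 500 * N ^ 2)
    (fun j τ => Frame [3, 9, 12] τ σ ∧ Between (σ 0 0) (τ 9) (fun b => A b ∨
      ∃ a < j, A a ∧ adjOf (σ 0) a b ≠ 0 ∧ memOf σ b = 0) B)
    hN hσ (hσ _ _) ?_ ?_ ?_) ?_ (fun _ _ h => h)
  · refine ⟨(Frame.refl _ _).set (by simp) _ _, ?_⟩
    rw [Store.set_of_ne _ (by norm_num)]
    exact hX.mono (by simp)
  · rintro i τ ⟨hf, -⟩
    simp [hf 0 (by simp)]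
  · rintro j τ hj hb hc ⟨hf, hXj⟩
    have e0 : τ 0 = σ 0 := hf 0 (by simp)
    have em : memOf τ = memOf σ := memOf_congr (hf 8 (by simp)) (hf 6 (by simp))
    refine (addNeighbors_reaches hb (by rwa [e0]) (by rwa [hc, e0]) (by rwa [e0])
      (by rwa [e0, em])).mono le_rfl ?_
    rintro ρ - ⟨hf', h⟩
    rw [e0, hc, em] at h
    refine ⟨(congrFun (hf' 3 (by simp)) 0).trans hc, (hf'.trans (by simp) hf).set (by simp) _ _, ?_⟩
    rw [Store.set_of_ne _ (by norm_num)]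
    refine h.mono ?_
    rintro b hb (h' | ⟨a, ha, h'⟩)
    · exact .inl (.inl h')
    · rcases Nat.lt_succ_iff_lt_or_eq.1 ha with ha | rfl
      · exact .inl (.inr ⟨a, ha, h'⟩)
      · exact .inr ⟨.inl h'.1, h'.2⟩
  · refine (loop_time hn le_rfl).trans ?_
    gcongr; decide

/-- Compute in array `9` the vertices reachable from the vertex in array `2` outside the mask. -/
def Prog.search : Prog :=
  .seq (.for 3 .order (.write 9 (.var 3) (.op .mul (.op .eq (.var 3) (.var 2))
    (.op .sub (.lit 1) (.mem 3))))) (.for 4 .order .expand)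

/-- After `n` rounds the set contains everything within `n` steps and nothing unreachable. The two
bounds coincide by `Within.of_any`. -/
theorem search_reaches {N : ℕ} {σ : Store} (hσ : Bdd N σ) (hn : σ 0 0 + 1 ≤ N) :
    Reaches N (1000 * N ^ 4) .search σ (fun τ => Frame [3, 4, 9, 12] τ σ ∧
      Between (σ 0 0) (τ 9) (Within (σ 0) (memOf σ) (σ 2 0) (σ 0 0))
        (fun b => ∃ i, Within (σ 0) (memOf σ) (σ 2 0) i b)) := by
  have hN : 1 ≤ N := by omega
  refine Reaches.mono (Reaches.seq (T₁ := 300 * N ^ 2) (T₂ := 700 * N ^ 4)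
    (Q := fun τ => Frame [3, 9] τ σ ∧
      Between (σ 0 0) (τ 9) (Within (σ 0) (memOf σ) (σ 2 0) 0)
        (fun b => ∃ i, Within (σ 0) (memOf σ) (σ 2 0) i b)) ?_ ?_) ?_ (fun _ _ h => h)
  · refine Reaches.mono (Reaches.for (m := σ 0 0) (T := 200 * N ^ 1)
      (fun j τ => Frame [3, 9] τ σ ∧ ∀ b < j, IsBit (τ 9 b) (b = σ 2 0 ∧ memOf σ b = 0))
      hN hσ (hσ _ _) ?_ ?_ ?_) ?_ ?_
    · exact ⟨(Frame.refl _ _).set (by simp) _ _, by simp⟩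
    · rintro i τ ⟨hf, -⟩
      simp [hf 0 (by simp)]
    · rintro j τ hj hb hc ⟨hf, hXj⟩
      have e2 : τ 2 = σ 2 := hf 2 (by simp)
      have em : memOf τ = memOf σ := memOf_congr (hf 8 (by simp)) (hf 6 (by simp))
      have hbit : IsBit ((if j = σ 2 0 then 1 else 0) * (1 - memOf σ j)) (j = σ 2 0 ∧ memOf σ j = 0) :=
        ((isBit_ite (j = σ 2 0)).and (isBit_mod _).not).of_iff
          (and_congr_right' (show ¬ memOf σ j = 1 ↔ _ by
            have : memOf σ j < 2 := Nat.mod_lt _ (by norm_num)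
            omega))
      refine Reaches.mono (.write hN hb (j := j) (by simp [hc]) ?_ (hbit.lt hN)
        (Q := fun ρ => ρ 3 0 = j ∧ Frame [3, 9] (ρ.set 3 0 (j + 1)) σ ∧ ∀ b < j + 1,
          IsBit (ρ.set 3 0 (j + 1) 9 b) (b = σ 2 0 ∧ memOf σ b = 0)) ?_) ?_ (fun _ _ h => h)
      · simp [Op.eval, hc, e2, em]
      · refine ⟨by simp [Store.set, hc], (hf.set (by simp) _ _).set (by simp) _ _, ?_⟩
        intro b hbj
        rw [Store.set_of_ne _ (by norm_num), Store.set_apply]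
        by_cases h : b = j
        · subst h; rw [if_pos rfl]; exact hbit
        · rw [if_neg h]; exact hXj b (by omega)
      · refine (le_mul_pow N 0).trans ?_
        gcongr; decide
    · refine (loop_time hn le_rfl).trans ?_
      gcongr; decide
    · rintro τ - ⟨hf, h⟩
      exact ⟨hf, fun b hb => ⟨(h b hb).1, (h b hb).2.2, fun h' => ⟨0, (h b hb).2.1 h'⟩⟩⟩
  · rintro τ hτ ⟨hf, hX⟩
    have e0 : τ 0 = σ 0 := hf 0 (by simp)
    refine Reaches.mono (Reaches.for (m := σ 0 0) (T := 600 * N ^ 3)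
      (fun j τ => Frame [3, 4, 9, 12] τ σ ∧
        Between (σ 0 0) (τ 9) (Within (σ 0) (memOf σ) (σ 2 0) j)
          (fun b => ∃ i, Within (σ 0) (memOf σ) (σ 2 0) i b))
      hN hτ (hσ _ _) ?_ ?_ ?_) ?_ (fun _ _ h => h)
    · refine ⟨(hf.trans (by simp) (Frame.refl _ _)).set (by simp) _ _, ?_⟩
      rwa [Store.set_of_ne _ (by norm_num)]
    · rintro i τ ⟨hf, -⟩
      simp [hf 0 (by simp)]
    · rintro j ρ hj hb hc ⟨hf', hXj⟩
      have r0 : ρ 0 = σ 0 := hf' 0 (by simp)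
      have rm : memOf ρ = memOf σ := memOf_congr (hf' 8 (by simp)) (hf' 6 (by simp))
      refine (expand_reaches hb (by rwa [r0]) (by rwa [r0]) ?_).mono le_rfl ?_
      · rw [r0, rm]
        rintro a ha b ⟨i, hi⟩ h h'
        exact ⟨i + 1, .inr ⟨a, ha, hi, h, h'⟩⟩
      · rintro ω - ⟨hf'', h⟩
        rw [r0, rm] at h
        refine ⟨(congrFun (hf'' 4 (by simp)) 0).trans hc,
          (hf''.trans (by simp) hf').set (by simp) _ _, ?_⟩
        rwa [Store.set_of_ne _ (by norm_num)]
    · refine (loop_time hn le_rfl).trans ?_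
      gcongr; decide
  · have := pow_mul_le hN (C := 300) (show 2 ≤ 4 by norm_num)
    omega

open Classical in
/-- The weight of the set with indicator function `S` together with the vertices reachable from `v`
outside of it. -/
noncomputable def loadOf (I S : ℕ → ℕ) (v : ℕ) : ℕ :=
  ∑ x ∈ Finset.range (I 0), ((if ∃ i, Within I S v i x then 1 else 0) + S x) * I (3 + x)

/-- Compute in array `10` the weight of the set in array `9` and the set given by the mask. -/
def Prog.sumWeights : Prog :=
  .seq (.write 10 (.lit 0) (.lit 0)) (.for 3 .order (.write 10 (.lit 0) (.op .add (.var 10)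
    (.op .mul (.op .add (.cell 9 3) (.mem 3)) (.wt 3)))))

theorem sumWeights_reaches {N : ℕ} {σ : Store} (hσ : Bdd N σ) (hn : σ 0 0 + 1 ≤ N)
    (hX : ∀ x < σ 0 0, σ 9 x < 2)
    (hw : 2 * ∑ x ∈ Finset.range (σ 0 0), σ 0 (3 + x) < 2 ^ N) :
    Reaches N (400 * N ^ 2) .sumWeights σ (fun τ => Frame [3, 10] τ σ ∧
      τ 10 0 = ∑ x ∈ Finset.range (σ 0 0), (σ 9 x + memOf σ x) * σ 0 (3 + x)) := by
  have hN : 1 ≤ N := by omega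
  have h1 : Reaches N (N * 5) (.write 10 (.lit 0) (.lit 0)) σ (fun τ => τ = σ.set 10 0 0) :=
    .write hN hσ rfl rfl (by positivity) rfl
  refine Reaches.mono (h1.seq (T₂ := 300 * N ^ 2) ?_) ?_ (fun _ _ h => h)
  · rintro τ hτ rfl
    refine Reaches.mono (Reaches.for (m := σ 0 0) (T := 200 * N ^ 1)
      (fun j τ => Frame [3, 10] τ σ ∧
        τ 10 0 = ∑ x ∈ Finset.range j, (σ 9 x + memOf σ x) * σ 0 (3 + x))
      hN hτ (hσ _ _) ?_ ?_ ?_) ?_ (fun _ _ h => h)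
    · exact ⟨((Frame.refl _ _).set (by simp) _ _).set (by simp) _ _, by simp [Store.set]⟩
    · rintro i τ ⟨hf, -⟩
      simp [hf 0 (by simp)]
    · rintro j τ hj hb hc ⟨hf, hY⟩
      have e0 : τ 0 = σ 0 := hf 0 (by simp)
      have e9 : τ 9 = σ 9 := hf 9 (by simp)
      have em : memOf τ = memOf σ := memOf_congr (hf 8 (by simp)) (hf 6 (by simp))
      refine Reaches.mono (.write hN hb (j := 0)
        (x := ∑ x ∈ Finset.range (j + 1), (σ 9 x + memOf σ x) * σ 0 (3 + x)) rfl ?_ ?_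
        (Q := fun ρ => ρ 3 0 = j ∧ Frame [3, 10] (ρ.set 3 0 (j + 1)) σ ∧
          ρ.set 3 0 (j + 1) 10 0 = ∑ x ∈ Finset.range (j + 1), (σ 9 x + memOf σ x) * σ 0 (3 + x))
        ?_) ?_ (fun _ _ h => h)
      · simp [Op.eval, hc, e0, e9, em, hY, Finset.sum_range_succ]
      -- A weight is counted at most twice, once for array `9` and once for the mask, whence the
      -- factor `2` in `hw`.
      · refine lt_of_le_of_lt ?_ hw
        rw [Finset.mul_sum]
        calc _ ≤ ∑ x ∈ Finset.range (j + 1), 2 * σ 0 (3 + x) := by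
              refine Finset.sum_le_sum fun x hx => ?_
              have := hX x (by have := Finset.mem_range.1 hx; omega)
              have : memOf σ x < 2 := Nat.mod_lt _ (by norm_num)
              gcongr
              omega
          _ ≤ _ := Finset.sum_le_sum_of_subset (Finset.range_mono (by omega))
      · exact ⟨by simp [Store.set, hc], (hf.set (by simp) _ _).set (by simp) _ _,
          by simp [Store.set]⟩
      · refine (le_mul_pow N 0).trans ?_
        gcongr; decide
    · refine (loop_time hn le_rfl).trans ?_
      gcongr; decide
  · have : N * 5 ≤ 5 * N ^ 2 := le_mul_pow N 1
    omega

end RAM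

/-! ### Testing all masks; the decision procedure -/

namespace RAM

/-- Put into cell `0` of array `11` whether some component exceeds the budget. -/
def Prog.testMask : Prog :=
  .seq (.write 11 (.lit 0) (.lit 0)) (.for 2 .order (.seq .search (.seq .sumWeights
    (.write 11 (.lit 0) (.op .lt (.lit 0) (.op .add (.var 11)
      (.op .lt (.read 0 (.lit 2)) (.var 10))))))))

theorem testMask_reaches {N : ℕ} {σ : Store} (hσ : Bdd N σ) (hn : σ 0 0 + 1 ≤ N)
    (hw : 2 * ∑ x ∈ Finset.range (σ 0 0), σ 0 (3 + x) < 2 ^ N)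
    (hW : ∀ v < σ 0 0, ∀ x < σ 0 0, ∀ i, Within (σ 0) (memOf σ) v i x →
      Within (σ 0) (memOf σ) v (σ 0 0) x) :
    Reaches N (2000 * N ^ 5) .testMask σ (fun τ => Frame [2, 3, 4, 9, 10, 11, 12] τ σ ∧
      IsBit (τ 11 0) (∃ v < σ 0 0, σ 0 2 < loadOf (σ 0) (memOf σ) v)) := by
  have hN : 1 ≤ N := by omega
  have h1 : Reaches N (N * 5) (.write 11 (.lit 0) (.lit 0)) σ (fun τ => τ = σ.set 11 0 0) :=
    .write hN hσ rfl rfl (by positivity) rfl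
  refine Reaches.mono (h1.seq (T₂ := 1900 * N ^ 5) ?_) ?_ (fun _ _ h => h)
  swap
  · have : N * 5 ≤ 5 * N ^ 5 := le_mul_pow N 4
    omega
  rintro τ hτ rfl
  refine Reaches.mono (Reaches.for (m := σ 0 0) (T := 1800 * N ^ 4)
    (fun j τ => Frame [2, 3, 4, 9, 10, 11, 12] τ σ ∧
      IsBit (τ 11 0) (∃ v < j, σ 0 2 < loadOf (σ 0) (memOf σ) v))
    hN hτ (hσ _ _) ?_ ?_ ?_) ?_ (fun _ _ h => h)
  · exact ⟨((Frame.refl _ _).set (by simp) _ _).set (by simp) _ _, by simp [Store.set, IsBit]⟩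
  · rintro i τ ⟨hf, -⟩
    simp [hf 0 (by simp)]
  · rintro j τ hj hb hc ⟨hf, hbad⟩
    have e0 : τ 0 = σ 0 := hf 0 (by simp)
    have em : memOf τ = memOf σ := memOf_congr (hf 8 (by simp)) (hf 6 (by simp))
    refine Reaches.mono ((search_reaches hb (by rwa [e0])).seq (T₂ := 500 * N ^ 2) ?_) ?_
      (fun _ _ h => h)
    swap
    · have := pow_mul_le hN (C := 500) (show 2 ≤ 4 by norm_num)
      omega
    rintro ρ hρ ⟨hf', hX⟩
    rw [e0, hc, em] at hX
    have r0 : ρ 0 = σ 0 := (hf' 0 (by simp)).trans e0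
    have rm : memOf ρ = memOf σ := (memOf_congr (hf' 8 (by simp)) (hf' 6 (by simp))).trans em
    refine Reaches.mono ((sumWeights_reaches hρ (by rwa [r0]) (by rw [r0]; exact fun x hx =>
      (hX x hx).1) (by rwa [r0])).seq (T₂ := 100 * N ^ 1) ?_) ?_ (fun _ _ h => h)
    swap
    · have := pow_mul_le hN (C := 100) (show 1 ≤ 2 by norm_num)
      omega
    rintro ω hω ⟨hf'', hY⟩
    have w0 : ω 0 = σ 0 := (hf'' 0 (by simp)).trans r0
    have w2 : ω 2 0 = j := ((congrFun ((hf'' 2 (by simp)).trans (hf' 2 (by simp))) 0)).trans hc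
    have w11 : ω 11 = τ 11 := (hf'' 11 (by simp)).trans (hf' 11 (by simp))
    have hfω : Frame [2, 3, 4, 9, 10, 11, 12] ω σ :=
      hf''.trans (by simp) (hf'.trans (by simp) hf)
    -- Here `hW` closes the gap between the lower and upper bounds on the searched set.
    have hYl : ω 10 0 = loadOf (σ 0) (memOf σ) j := by
      rw [hY, r0, rm, loadOf]
      refine Finset.sum_congr rfl fun x hx => ?_
      obtain ⟨h1, h2, h3⟩ := hX x (Finset.mem_range.1 hx)
      congr 2
      split
      · rename_i h
        obtain ⟨i, hi⟩ := h
        have := h2 (hW j hj x (Finset.mem_range.1 hx) i hi)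
        omega
      · rename_i h
        by_contra h'
        exact h (h3 h')
    have hbit : IsBit _ (∃ v < j + 1, σ 0 2 < loadOf (σ 0) (memOf σ) v) :=
      (isBit_ite (0 < τ 11 0 + if σ 0 2 < loadOf (σ 0) (memOf σ) j then 1 else 0)).of_iff <| by
        constructor
        · intro h
          by_cases h' : σ 0 2 < loadOf (σ 0) (memOf σ) j
          · exact ⟨j, by omega, h'⟩
          · rw [if_neg h'] at h
            obtain ⟨v, hv, h⟩ := hbad.2.1 (by omega)
            exact ⟨v, by omega, h⟩
        · rintro ⟨v, hv, h⟩
          rcases Nat.lt_succ_iff_lt_or_eq.1 hv with hv | rfl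
          · have := hbad.2.2 ⟨v, hv, h⟩
            omega
          · rw [if_pos h]; omega
    refine Reaches.mono (.write hN hω (j := 0) rfl ?_ (hbit.lt hN)
      (Q := fun ρ => ρ 2 0 = j ∧ Frame [2, 3, 4, 9, 10, 11, 12] (ρ.set 2 0 (j + 1)) σ ∧
        IsBit (ρ.set 2 0 (j + 1) 11 0) (∃ v < j + 1, σ 0 2 < loadOf (σ 0) (memOf σ) v)) ?_) ?_
        (fun _ _ h => h)
    · simp [Op.eval, w0, w11, hYl]
    · refine ⟨by simp [Store.set, w2], (hfω.set (by simp) _ _).set (by simp) _ _, ?_⟩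
      simpa [Store.set] using hbit
    · refine (le_mul_pow N 0).trans ?_
      gcongr; decide
  · refine (loop_time hn le_rfl).trans ?_
    gcongr; decide

/-- The indicator function of the union of the classes selected by the mask `s`. -/
def selected (P : ℕ → ℕ) (s : ℕ) (x : ℕ) : ℕ := s / P x % 2

/-- Test all masks. -/
def Prog.testAll : Prog :=
  .for 8 (.var 7) (.seq .testMask (.write 1 (.lit 0) (.op .lt (.lit 0)
    (.op .add (.var 1) (.op .eq (.var 11) (.lit 0))))))

theorem testAll_reaches {N M : ℕ} {σ : Store} (hσ : Bdd N σ) (hn : σ 0 0 + 1 ≤ N)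
    (hM : σ 7 0 = M) (hM1 : 1 ≤ M)
    (h0 : σ 1 0 = 0) (hw : 2 * ∑ x ∈ Finset.range (σ 0 0), σ 0 (3 + x) < 2 ^ N)
    (hW : ∀ s, ∀ v < σ 0 0, ∀ x < σ 0 0, ∀ i, Within (σ 0) (selected (σ 6) s) v i x →
      Within (σ 0) (selected (σ 6) s) v (σ 0 0) x) :
    Reaches N (M * (6000 * N ^ 5)) .testAll σ (fun τ =>
      Frame [1, 2, 3, 4, 8, 9, 10, 11, 12] τ σ ∧ IsBit (τ 1 0)
        (∃ s < M, ∀ v < σ 0 0, loadOf (σ 0) (selected (σ 6) s) v ≤ σ 0 2)) := by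
  have hN : 1 ≤ N := by omega
  refine Reaches.mono (Reaches.for (m := M) (T := 2100 * N ^ 5)
    (fun j τ => Frame [1, 2, 3, 4, 8, 9, 10, 11, 12] τ σ ∧ IsBit (τ 1 0)
        (∃ s < j, ∀ v < σ 0 0, loadOf (σ 0) (selected (σ 6) s) v ≤ σ 0 2))
    hN hσ (hM ▸ hσ _ _) ?_ ?_ ?_) ?_ (fun _ _ h => h)
  · exact ⟨(Frame.refl _ _).set (by simp) _ _, by simp [Store.set, IsBit, h0]⟩
  · rintro i τ ⟨hf, -⟩
    simp [hf 7 (by simp), hM]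
  · rintro s τ hj hb hc ⟨hf, hans⟩
    have e0 : τ 0 = σ 0 := hf 0 (by simp)
    have em : memOf τ = selected (σ 6) s := by
      funext x; simp [memOf, selected, hc, hf 6]
    refine Reaches.mono ((testMask_reaches hb (by rwa [e0]) (by rwa [e0])
      (by rw [e0, em]; exact hW s)).seq (T₂ := 100 * N ^ 1) ?_) ?_ (fun _ _ h => h)
    swap
    · have := pow_mul_le hN (C := 100) (show 1 ≤ 5 by norm_num)
      omega
    rintro ρ hρ ⟨hf', hbad⟩
    rw [e0, em] at hbad
    have r1 : ρ 1 = τ 1 := hf' 1 (by simp)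
    have r8 : ρ 8 0 = s := (congrFun (hf' 8 (by simp)) 0).trans hc
    have hbit : IsBit _ (∃ t < s + 1, ∀ v < σ 0 0, loadOf (σ 0) (selected (σ 6) t) v ≤ σ 0 2) :=
      (isBit_ite (0 < τ 1 0 + if ρ 11 0 = 0 then 1 else 0)).of_iff <| by
        constructor
        · intro h
          by_cases h' : ρ 11 0 = 0
          · refine ⟨s, by omega, fun v hv => ?_⟩
            by_contra hlt
            exact hbad.2.2 ⟨v, hv, by omega⟩ h'
          · rw [if_neg h'] at h
            obtain ⟨t, ht, h⟩ := hans.2.1 (by omega)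
            exact ⟨t, by omega, h⟩
        · rintro ⟨t, ht, h⟩
          rcases Nat.lt_succ_iff_lt_or_eq.1 ht with ht | rfl
          · have := hans.2.2 ⟨t, ht, h⟩
            omega
          · rw [if_pos]
            · omega
            · by_contra h'
              obtain ⟨v, hv, h''⟩ := hbad.2.1 h'
              have := h v hv
              omega
    refine Reaches.mono (.write hN hρ (j := 0) rfl ?_ (hbit.lt hN)
      (Q := fun ω => ω 8 0 = s ∧
        Frame [1, 2, 3, 4, 8, 9, 10, 11, 12] (ω.set 8 0 (s + 1)) σ ∧
        IsBit (ω.set 8 0 (s + 1) 1 0)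
          (∃ t < s + 1, ∀ v < σ 0 0, loadOf (σ 0) (selected (σ 6) t) v ≤ σ 0 2)) ?_) ?_
        (fun _ _ h => h)
    · simp only [Exp.val_op, Op.eval, Exp.val_read, Exp.val_lit, r1]
      congr
    · refine ⟨by simp [Store.set, r8],
        ((hf'.trans (by simp) hf).set (by simp) _ _).set (by simp) _ _, ?_⟩
      simpa [Store.set] using hbit
    · refine (le_mul_pow N 0).trans ?_
      gcongr; decide
  · have h1 : N * ((Exp.var 7).weight + 30) ≤ 100 * N ^ 5 :=
      (le_mul_pow N 4).trans (by gcongr; decide)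
    calc _ ≤ (M + M) * (2100 * N ^ 5 + 100 * N ^ 5) := by gcongr
      _ ≤ _ := by nlinarith [Nat.zero_le (M * N ^ 5)]

/-- The decision procedure. -/
def Prog.decideIntegrity : Prog :=
  .seq .classes (.seq .testAll (.write 1 (.lit 0) (.op .mul (.var 1)
    (.op .eq (.read 0 (.lit 1)) (.lit 0)))))

/-- All facts about graphs enter as hypotheses on the input array, so the analysis of the program is
purely about numbers. Only `|k|` serves as budget; the last multiplication by the sign test rejects
negative `k`. -/
theorem decideIntegrity_reaches {N : ℕ} {σ : Store} (hσ : Bdd N σ) (hn : σ 0 0 + 1 ≤ N)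
    (h0 : σ 1 0 = 0) (hw : 2 * ∑ x ∈ Finset.range (σ 0 0), σ 0 (3 + x) < 2 ^ N)
    (ht : ∀ u < σ 0 0, ∀ v < σ 0 0, ∀ w < σ 0 0, Agree (σ 0) u v (σ 0 0) →
      Agree (σ 0) v w (σ 0 0) → Agree (σ 0) u w (σ 0 0))
    {m : ℕ} (hm : ∀ P m', Classes (σ 0) P (σ 0 0) m' → m' = m) {ans : Prop}
    (hans : ∀ P, Classes (σ 0) P (σ 0 0) m →
      ((∃ s < 2 ^ m, ∀ v < σ 0 0, loadOf (σ 0) (selected P s) v ≤ σ 0 2) ∧ σ 0 1 = 0 ↔ ans))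
    (hW : ∀ S, ∀ v < σ 0 0, ∀ x < σ 0 0, ∀ i, Within (σ 0) S v i x →
      Within (σ 0) S v (σ 0 0) x) :
    Reaches N (2 ^ m * (8000 * N ^ 5)) .decideIntegrity σ (fun τ => IsBit (τ 1 0) ans) := by
  have hN : 1 ≤ N := by omega
  have h2m : 1 ≤ 2 ^ m := Nat.one_le_two_pow
  refine Reaches.mono ((classes_reaches hσ hn ht).seq
    (T₂ := 2 ^ m * (6000 * N ^ 5) + 100 * N ^ 5) ?_) ?_ (fun _ _ h => h)
  swap
  · have := pow_mul_le hN (C := 1000) (show 4 ≤ 5 by norm_num)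
    calc _ ≤ 2 ^ m * (6000 * N ^ 5) + 1 * (2000 * N ^ 5) := by omega
      _ ≤ 2 ^ m * (6000 * N ^ 5) + 2 ^ m * (2000 * N ^ 5) := by gcongr
      _ = _ := by ring
  rintro τ hτ ⟨hf, m', hM, hcl⟩
  obtain rfl := hm _ _ hcl
  have e0 : τ 0 = σ 0 := hf 0 (by simp)
  have e1 : τ 1 0 = 0 := (congrFun (hf 1 (by simp)) 0).trans h0
  refine (testAll_reaches hτ (by rwa [e0]) hM h2m e1 (by rwa [e0])
    (by rw [e0]; exact fun s => hW _)).seq ?_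
  rintro ρ hρ ⟨hf', hbit⟩
  rw [e0] at hbit
  have r0 : ρ 0 = σ 0 := (hf' 0 (by simp)).trans e0
  have hbit' := (hbit.and (isBit_ite (σ 0 1 = 0))).of_iff (hans _ hcl)
  refine Reaches.mono (.write hN hρ (j := 0) rfl ?_ (hbit'.lt hN)
    (Q := fun ω => IsBit (ω 1 0) ans) ?_) ?_ (fun _ _ h => h)
  · simp [Op.eval, r0]
  · simpa [Store.set] using hbit'
  · refine (le_mul_pow N 4).trans ?_
    gcongr; decide

end RAM

/-! ### Twin classes, irredundant sets and the cost of a set -/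

namespace VertexIntegrity

variable {V : Type*} {G : SimpleGraph V}

theorem twins_iff {u v : V} :
    Twins G u v ↔ ∀ z, z ≠ u → z ≠ v → (G.Adj u z ↔ G.Adj v z) := by
  simp only [Twins, Set.ext_iff, Set.mem_sdiff, SimpleGraph.mem_neighborSet, Set.mem_singleton_iff]
  refine ⟨fun h z hu hv => by simpa [hu, hv] using h z, fun h z => ?_⟩
  by_cases hu : z = u
  · simp [hu]
  · by_cases hv : z = v
    · simp [hv]
    · simp [hu, hv, h z hu hv]

theorem Twins.refl (G : SimpleGraph V) (u : V) : Twins G u u := rfl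

theorem Twins.symm {u v : V} (h : Twins G u v) : Twins G v u := Eq.symm h

theorem Twins.trans {u v w : V} (h : Twins G u v) (h' : Twins G v w) : Twins G u w := by
  rw [twins_iff] at *
  intro z hu hw
  by_cases hv : z = v
  · subst hv
    by_cases huw : u = w
    · rw [huw]
    · have h1 := h w (Ne.symm huw) hw.symm
      have h2 := h' u hu.symm huw
      rw [G.adj_comm u z, h2, G.adj_comm w u, h1, G.adj_comm z w]
  · exact (h z hu hv).trans (h' z hv hw)

/-- The partition into twin classes. -/
def twinSetoid (G : SimpleGraph V) : Setoid V :=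
  ⟨Twins G, Twins.refl G, Twins.symm, Twins.trans⟩

theorem isTwinClass_iff {T : Set V} : IsTwinClass G T ↔ ∃ v, T = {u | Twins G u v} := by
  constructor
  · rintro ⟨⟨⟨v, hv⟩, hT⟩, hmax⟩
    exact ⟨v, Set.Subset.antisymm (fun u hu => hT u hu v hv) (hmax ⟨⟨v, Twins.refl G v⟩,
      fun a ha b hb => Twins.trans ha (Twins.symm hb)⟩ fun u hu => hT u hu v hv)⟩
  · rintro ⟨v, rfl⟩
    exact ⟨⟨⟨v, Twins.refl G v⟩, fun a ha b hb => Twins.trans ha (Twins.symm hb)⟩,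
      fun Y hY hle u hu => hY.2 u hu v (hle (Twins.refl G v))⟩

theorem nd_eq (G : SimpleGraph V) : nd G = Nat.card (Quotient (twinSetoid G)) := by
  have hmk : Function.Surjective (Quotient.mk (twinSetoid G)) := Quotient.mk_surjective
  have hinj : Function.Injective
      (fun q : Quotient (twinSetoid G) => Quotient.mk (twinSetoid G) ⁻¹' {q}) :=
    (Set.preimage_injective.2 hmk).comp Set.singleton_injective
  rw [nd, ← Set.ncard_univ, ← Set.ncard_image_of_injective _ hinj]
  congr 1
  ext T
  simp only [Set.mem_ofPred_eq, isTwinClass_iff, Set.image_univ, Set.mem_range]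
  constructor
  · rintro ⟨v, rfl⟩
    exact ⟨⟦v⟧, Set.ext fun u => Quotient.eq (r := twinSetoid G)⟩
  · rintro ⟨q, rfl⟩
    obtain ⟨v, rfl⟩ := hmk q
    exact ⟨v, Set.ext fun u => Quotient.eq (r := twinSetoid G)⟩

theorem respectsTwinClasses_iff {S : Set V} :
    RespectsTwinClasses G S ↔ ∀ u v, Twins G u v → u ∈ S → v ∈ S := by
  constructor
  · intro h u v huv hu
    rcases h _ (isTwinClass_iff.2 ⟨v, rfl⟩) with h | h
    · exact h (Twins.refl G v)
    · exact absurd (h ▸ ⟨huv, hu⟩ : u ∈ (∅ : Set V)) (Set.notMem_empty u)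
  · rintro h T hT
    obtain ⟨v, rfl⟩ := isTwinClass_iff.1 hT
    by_cases hv : v ∈ S
    · exact .inl fun u hu => h v u (Twins.symm hu) hv
    · exact .inr (Set.eq_empty_of_forall_notMem fun u hu => hv (h u v hu.1 hu.2))

theorem ncard_respectsTwinClasses [Finite V] (G : SimpleGraph V) :
    {S : Set V | RespectsTwinClasses G S}.ncard = 2 ^ nd G := by
  classical
  have hmk : Function.Surjective (Quotient.mk (twinSetoid G)) := Quotient.mk_surjective
  have := Fintype.ofFinite (Quotient (twinSetoid G))
  rw [nd_eq, Nat.card_eq_fintype_card, ← Fintype.card_set, ← Nat.card_eq_fintype_card,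
    ← Set.ncard_univ, ← Set.ncard_image_of_injective _ (Set.preimage_injective.2 hmk)]
  congr 1
  ext S
  simp only [Set.mem_ofPred_eq, respectsTwinClasses_iff, Set.image_univ, Set.mem_range]
  constructor
  · intro h
    refine ⟨Quotient.mk (twinSetoid G) '' S, Set.Subset.antisymm ?_ (Set.subset_preimage_image _ _)⟩
    rintro v ⟨u, hu, huv⟩
    exact h u v (Quotient.eq.1 huv) hu
  · rintro ⟨A, rfl⟩ u v huv hu
    rwa [Set.mem_preimage, ← Quotient.sound (s := twinSetoid G) huv]

/-- `b` can be reached from `a` by a walk that does not enter `S`. -/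
def ReachAvoiding (G : SimpleGraph V) (S : Set V) : V → V → Prop :=
  Relation.ReflTransGen fun x y => G.Adj x y ∧ y ∉ S

theorem ReachAvoiding.notMem {S : Set V} {a b : V} (h : ReachAvoiding G S a b) (ha : a ∉ S) :
    b ∉ S := by
  induction h with
  | refl => exact ha
  | tail _ h _ => exact h.2

/-- Replaces components of an induced subgraph on a subtype by walks in `G`, on which the remaining
arguments are inductions. -/
theorem mk_eq_mk_iff {S : Set V} {a b : V} (ha : a ∉ S) (hb : b ∉ S) :
    ((G.induce Sᶜ).connectedComponentMk ⟨a, ha⟩ = (G.induce Sᶜ).connectedComponentMk ⟨b, hb⟩) ↔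
      ReachAvoiding G S a b := by
  rw [SimpleGraph.ConnectedComponent.eq, SimpleGraph.reachable_iff_reflTransGen]
  constructor
  · intro h
    exact h.lift (p := fun x y => G.Adj x y ∧ y ∉ S) Subtype.val fun x y hxy => ⟨hxy, y.2⟩
  · intro h
    have key : ∀ c, ReachAvoiding G S a c → ∀ hc : c ∉ S,
        Relation.ReflTransGen (G.induce Sᶜ).Adj ⟨a, ha⟩ ⟨c, hc⟩ := by
      intro c h
      induction h with
      | refl => exact fun _ => .refl
      | @tail x y hax hxy ih =>
        exact fun hc => (ih (ReachAvoiding.notMem hax ha)).tail hxy.1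
    exact key b h hb

theorem compVerts_mk {S : Set V} {a : V} (ha : a ∉ S) :
    compVerts ((G.induce Sᶜ).connectedComponentMk ⟨a, ha⟩ : Component G S) =
      {b | ReachAvoiding G S a b} := by
  ext b
  simp only [compVerts, Set.mem_image, SimpleGraph.ConnectedComponent.mem_supp_iff,
    Subtype.exists, Set.mem_ofPred_eq]
  constructor
  · rintro ⟨c, hc, h, rfl⟩
    exact (mk_eq_mk_iff ha hc).1 h.symm
  · intro h
    have hb := h.notMem ha
    exact ⟨b, hb, ((mk_eq_mk_iff ha hb).2 h).symm, rfl⟩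

theorem component_subsingleton_iff {S : Set V} {v : V} :
    {C : Component G S | ∃ u ∈ compVerts C, G.Adj v u}.Subsingleton ↔
      ∀ x ∉ S, ∀ y ∉ S, G.Adj v x → G.Adj v y → ReachAvoiding G S x y := by
  constructor
  · intro h x hx y hy hvx hvy
    refine (mk_eq_mk_iff hx hy).1 (h ⟨x, ?_, hvx⟩ ⟨y, ?_, hvy⟩)
    · rw [compVerts_mk]; exact .refl
    · rw [compVerts_mk]; exact .refl
  · rintro h C ⟨x, hx, hvx⟩ D ⟨y, hy, hvy⟩
    obtain ⟨⟨x, hxS⟩, rfl, rfl⟩ := hx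
    obtain ⟨⟨y, hyS⟩, rfl, rfl⟩ := hy
    exact (mk_eq_mk_iff hxS hyS).2 (h x hxS y hyS hvx hvy)

/-- If `u ∈ S` has a twin `v ∉ S`, each neighbor of `u` outside `S` is `v` or adjacent to `v`. So
only the component of `v` contains neighbors of `u`. -/
theorem IsIrredundant.respectsTwinClasses {S : Set V} (h : IsIrredundant G S) :
    RespectsTwinClasses G S := by
  rw [respectsTwinClasses_iff]
  intro u v huv hu
  by_contra hv
  refine h u hu ⟨hu, component_subsingleton_iff.2 fun x hx y hy hux huy => ?_⟩
  have hadj : ∀ z, z ∉ S → G.Adj u z → z ≠ v → G.Adj v z := fun z hz huz hzv =>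
    (twins_iff.1 huv z (by rintro rfl; exact hz hu) hzv).1 huz
  have hxv : ReachAvoiding G S x v := by
    by_cases h : x = v
    · rw [h]; exact .refl
    · exact .single ⟨(hadj x hx hux h).symm, hv⟩
  by_cases h : y = v
  · rwa [h]
  · exact hxv.tail ⟨hadj y hy huy h, hy⟩

variable [Fintype V] {w : V → ℕ+}

open Classical in
theorem weightOf_eq (w : V → ℕ+) (X : Set V) :
    weightOf w X = ∑ v, if v ∈ X then (w v : ℕ) else 0 := by
  rw [weightOf, Finset.sum_filter]

theorem weightOf_mono {X Y : Set V} (h : X ⊆ Y) : weightOf w X ≤ weightOf w Y := by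
  classical
  simp only [weightOf_eq]
  refine Finset.sum_le_sum fun v _ => ?_
  by_cases hX : v ∈ X
  · simp [hX, h hX]
  · simp [hX]

theorem weightOf_insert_le (v : V) (X : Set V) :
    weightOf w (insert v X) ≤ w v + weightOf w X := by
  classical
  simp only [weightOf_eq]
  calc _ ≤ ∑ x, ((if x = v then (w v : ℕ) else 0) + if x ∈ X then (w x : ℕ) else 0) := by
        refine Finset.sum_le_sum fun x _ => ?_
        by_cases h : x = v
        · subst h; simp
        · simp [h]
    _ = _ := by rw [Finset.sum_add_distrib]; simp

theorem weightOf_diff_singleton {v : V} {S : Set V} (hv : v ∈ S) :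
    weightOf w (S \ {v}) + w v = weightOf w S := by
  classical
  simp only [weightOf_eq]
  have : (w v : ℕ) = ∑ x, if x = v then (w x : ℕ) else 0 := by simp
  rw [this, ← Finset.sum_add_distrib]
  refine Finset.sum_congr rfl fun x _ => ?_
  by_cases h : x = v
  · subst h; simp [hv]
  · simp [h]

/-- The separate bound on `weightOf w S` matters only for `S = V`, where no `a` exists and the
supremum is `0`. -/
theorem cost_le_iff {S : Set V} {k : ℕ} : cost G w S ≤ k ↔ weightOf w S ≤ k ∧
    ∀ a ∉ S, weightOf w S + weightOf w {b | ReachAvoiding G S a b} ≤ k := by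
  have hfin : Finite (Component G S) := Quot.finite _
  have hb : BddAbove (Set.range fun C : Component G S => weightOf w (compVerts C)) :=
    (Set.finite_range _).bddAbove
  rw [cost, maxCompWeight]
  constructor
  · intro h
    refine ⟨by omega, fun a ha => ?_⟩
    have := le_ciSup hb ((G.induce Sᶜ).connectedComponentMk ⟨a, ha⟩)
    simp only [compVerts_mk] at this
    omega
  · rintro ⟨h, h'⟩
    have : (⨆ C : Component G S, weightOf w (compVerts C)) ≤ k - weightOf w S := by
      refine ciSup_le' fun C => ?_
      induction C using SimpleGraph.ConnectedComponent.ind with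
      | h a =>
        obtain ⟨a, ha⟩ := a
        have := h' a ha
        rw [compVerts_mk]
        omega
    omega

theorem IsRedundant.cost_diff_le {S : Set V} {v : V} (h : IsRedundant G S v) :
    cost G w (S \ {v}) ≤ cost G w S := by
  obtain ⟨hv, hsub⟩ := h
  rw [component_subsingleton_iff] at hsub
  obtain ⟨h1, h2⟩ := (cost_le_iff (G := G) (w := w) (S := S)).1 le_rfl
  have hwv := weightOf_diff_singleton (w := w) hv
  -- It suffices to enclose the new component in `v` plus one old component: the weight `w v` gained
  -- there is the weight lost by `S`.
  have key : ∀ a₀ ∉ S, ∀ X, X ⊆ insert v {b | ReachAvoiding G S a₀ b} →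
      weightOf w (S \ {v}) + weightOf w X ≤ cost G w S := fun a₀ ha₀ X hX => by
    have := h2 a₀ ha₀
    have := (weightOf_mono (w := w) hX).trans (weightOf_insert_le v _)
    omega
  have hmem : ∀ c, c ∉ S \ {v} → c ≠ v → c ∉ S := fun c hc hcv h => hc ⟨h, hcv⟩
  rw [cost_le_iff]
  refine ⟨by omega, fun a ha => ?_⟩
  by_cases hav : a = v
  · subst hav
    by_cases hx : ∃ x ∉ S, G.Adj a x
    · obtain ⟨x, hxS, hx⟩ := hx
      refine key x hxS _ fun b (hb : ReachAvoiding _ _ _ _) => ?_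
      induction hb with
      | refl => exact .inl rfl
      | @tail b c hab hbc ih =>
        by_cases hcv : c = a
        · exact .inl hcv
        · have hc := hmem c hbc.2 hcv
          rcases ih with rfl | ih
          · exact .inr (hsub x hxS c hc hx hbc.1)
          · exact .inr (Relation.ReflTransGen.tail ih ⟨hbc.1, hc⟩)
    -- Without neighbors outside `S`, the returned vertex forms a component of its own.
    · have hsing : {b | ReachAvoiding G (S \ {a}) a b} ⊆ insert a ∅ := by
        intro b (hb : ReachAvoiding _ _ _ _)
        induction hb with
        | refl => exact .inl rfl
        | @tail b c hab hbc ih =>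
          by_cases hcv : c = a
          · exact .inl hcv
          · rcases ih with rfl | ih
            · exact absurd ⟨c, hmem c hbc.2 hcv, hbc.1⟩ hx
            · exact ih.elim
      have := (weightOf_mono (w := w) hsing).trans (weightOf_insert_le a _)
      have h0 : weightOf w (∅ : Set V) = 0 := by simp [weightOf]
      omega
  · have haS := hmem a ha hav
    refine key a haS _ fun b (hb : ReachAvoiding _ _ _ _) => ?_
    -- The induction records whether the walk stands at `v`. A passage through `v` enters from one
    -- neighbor and leaves to another, and `hsub` joins these two by a walk avoiding `S`.
    have : (b ≠ v ∧ ReachAvoiding G S a b) ∨ (b = v ∧ ∃ x, ReachAvoiding G S a x ∧ G.Adj v x) := by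
      induction hb with
      | refl => exact .inl ⟨hav, .refl⟩
      | @tail b c hab hbc ih =>
        by_cases hcv : c = v
        · rcases ih with ih | ih
          · exact .inr ⟨hcv, b, ih.2, by rw [← hcv]; exact hbc.1.symm⟩
          · exact absurd (hcv.trans ih.1.symm) hbc.1.ne'
        · have hc := hmem c hbc.2 hcv
          rcases ih with ih | ⟨rfl, x, hx, hvx⟩
          · exact .inl ⟨hcv, Relation.ReflTransGen.tail ih.2 ⟨hbc.1, hc⟩⟩
          · exact .inl ⟨hcv, Relation.ReflTransGen.trans hx
              (hsub x (hx.notMem haS) c hc hvx hbc.1)⟩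
    rcases this with h | h
    · exact .inr h.2
    · exact .inl h.1

theorem wvi_le (G : SimpleGraph V) (w : V → ℕ+) (S : Set V) : wvi G w ≤ cost G w S :=
  ciInf_le (OrderBot.bddBelow _) S

theorem isWviSet_iff {S : Set V} : IsWviSet G w S ↔ cost G w S ≤ wvi G w := by
  simp [IsWviSet, IsWviKSet]

/-- In an inclusion-minimal optimal set, removing a redundant vertex would give a smaller optimal
set. -/
theorem exists_isWviSet_isIrredundant (G : SimpleGraph V) (w : V → ℕ+) :
    ∃ S : Set V, IsWviSet G w S ∧ IsIrredundant G S := by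
  have hne : {S : Set V | IsWviSet G w S}.Nonempty := by
    obtain ⟨S, hS⟩ := ciInf_mem fun S : Set V => cost G w S
    exact ⟨S, isWviSet_iff.2 hS.le⟩
  obtain ⟨S, hS⟩ := (Set.toFinite {S : Set V | IsWviSet G w S}).exists_minimal hne
  refine ⟨S, hS.1, fun v hv hr => ?_⟩
  have := hS.2 (isWviSet_iff.2 (hr.cost_diff_le.trans (isWviSet_iff.1 hS.1))) Set.sdiff_subset
  exact (this hv).2 rfl

end VertexIntegrity

/-! ### Stabilization of the search, and bounds for the initial memory -/

namespace RAM

theorem Within.mono {I S : ℕ → ℕ} {v i j x : ℕ} (hij : i ≤ j) (h : Within I S v i x) :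
    Within I S v j x := by
  induction hij with
  | refl => exact h
  | step _ ih => exact .inl ih

theorem Within.of_any {I S : ℕ → ℕ} {v i x : ℕ} (hx : x < I 0) (h : Within I S v i x) :
    Within I S v (I 0) x := by
  classical
  let F : ℕ → Finset ℕ := fun i => (Finset.range (I 0)).filter (Within I S v i)
  have hF : ∀ {i y}, y ∈ F i ↔ y < I 0 ∧ Within I S v i y := by simp [F]
  have hmono : ∀ i, F i ⊆ F (i + 1) := fun i y hy => hF.2 ⟨(hF.1 hy).1, .inl (hF.1 hy).2⟩
  -- The balls increase inside a set of `I 0` elements, so two consecutive ones agree by step `I 0`;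
  -- from there on the sequence is constant.
  have hcard : ∀ i, i ≤ (F i).card ∨ ∃ j < i, F j = F (j + 1) := by
    intro i
    induction i with
    | zero => exact .inl (Nat.zero_le _)
    | succ i ih =>
      by_cases h : F i = F (i + 1)
      · exact .inr ⟨i, by omega, h⟩
      · rcases ih with ih | ⟨j, hj, h'⟩
        · have := Finset.card_lt_card ((hmono i).ssubset_of_ne h)
          exact .inl (by omega)
        · exact .inr ⟨j, by omega, h'⟩
  have hstep : ∀ j, F j = F (j + 1) → F (j + 1) = F (j + 2) := by
    intro j hj
    refine Finset.Subset.antisymm (hmono _) fun y hy => ?_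
    obtain ⟨hyn, hy | ⟨a, ha, haw, h1, h2⟩⟩ := hF.1 hy
    · exact hF.2 ⟨hyn, hy⟩
    · have := hF.2 ⟨ha, haw⟩
      rw [← hj] at this
      exact hF.2 ⟨hyn, .inr ⟨a, ha, (hF.1 this).2, h1, h2⟩⟩
  have hle : ∀ j, (F j).card ≤ I 0 := fun j => by
    simpa using Finset.card_filter_le (Finset.range (I 0)) (Within I S v j)
  obtain ⟨j, hj, he⟩ : ∃ j < I 0 + 1, F j = F (j + 1) := by
    refine (hcard (I 0 + 1)).resolve_left fun h => ?_
    have := hle (I 0 + 1)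
    omega
  have hconst : ∀ k, F (j + k) = F (j + k + 1) := by
    intro k
    induction k with
    | zero => exact he
    | succ k ih => exact hstep _ ih
  have hall : ∀ k, F (j + k) = F j := by
    intro k
    induction k with
    | zero => rfl
    | succ k ih => rw [← ih]; exact (hconst k).symm
  have hxi : x ∈ F (j + i) := hF.2 ⟨hx, h.mono (by omega)⟩
  rw [hall] at hxi
  exact (hF.1 hxi).2.mono (by omega)

theorem initStore_bdd (l : List ℕ) : Bdd (inputSize l) (initStore l) := by
  intro a i
  have key : ∀ x ∈ l, x < 2 ^ inputSize l := fun x hx => by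
    refine Nat.size_le.1 ?_
    have : bits x ≤ inputSize l :=
      List.single_le_sum (fun _ _ => Nat.zero_le _) _ (List.mem_map_of_mem hx)
    unfold bits at this
    omega
  unfold initStore
  split
  · rw [List.getD_eq_getElem?_getD]
    by_cases hi : i < l.length
    · rw [List.getElem?_eq_getElem hi]
      exact key _ (List.getElem_mem hi)
    · rw [List.getElem?_eq_none (by omega)]
      simp
  · positivity

theorem length_le_inputSize (l : List ℕ) : l.length ≤ inputSize l := by
  induction l with
  | nil => simp
  | cons x l ih =>
    have : inputSize (x :: l) = bits x + inputSize l := by simp [inputSize]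
    rw [this, List.length_cons]
    unfold bits
    omega

end RAM

/-! ### Correctness on encoded instances and the final time bound -/

namespace VertexIntegrity

open RAM

namespace Instance

variable (x : Instance)

/-- The input array of an instance. -/
noncomputable abbrev input : ℕ → ℕ := initStore x.encode 0

theorem input_zero : x.input 0 = x.n := by simp [input, initStore, encode]

theorem input_one : x.input 1 = if x.k < 0 then 1 else 0 := by simp [input, initStore, encode]

theorem input_two : x.input 2 = x.k.natAbs := by simp [input, initStore, encode]

theorem input_weight (v : Fin x.n) : x.input (3 + v) = x.w v := by
  simp only [input, initStore, if_true, encode, List.append_assoc, List.getD_eq_getElem?_getD]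
  rw [List.getElem?_append_right (by simp), List.getElem?_append_left (by simp)]
  simp

open Classical in
theorem input_adj (u v : Fin x.n) : adjOf x.input u v = if x.G.Adj u v then 1 else 0 := by
  have hlt : (u : ℕ) * x.n + v < x.n * x.n := by
    have := u.2
    have := v.2
    nlinarith
  have hpos : 0 < x.n := u.pos
  rw [adjOf, input_zero]
  simp only [input, initStore, if_true, encode, List.append_assoc, List.getD_eq_getElem?_getD]
  rw [List.getElem?_append_right (by simp; omega), List.getElem?_append_right (by simp; omega)]
  have : (List.ofFn fun u => List.ofFn fun v => if x.G.Adj u v then 1 else 0).flatten =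
      List.ofFn fun i : Fin (x.n * x.n) => if x.G.Adj i.divNat i.modNat then 1 else 0 := by
    rw [List.ofFn_mul]
    congr 2
    funext a
    congr 1
    funext b
    have h1 : Fin.divNat (⟨a * x.n + b, by
        have := a.2
        have := b.2
        nlinarith⟩ : Fin (x.n * x.n)) = a := by
      ext
      simp [Fin.divNat, Nat.add_div_of_dvd_right, hpos]
    have h2 : Fin.modNat (⟨a * x.n + b, by
        have := a.2
        have := b.2
        nlinarith⟩ : Fin (x.n * x.n)) = b := by
      ext
      simp [Fin.modNat, Nat.mod_eq_of_lt b.2]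
    rw [h1, h2]
  rw [this]
  have e : 3 + x.n + ((u : ℕ) * x.n + v) -
      [x.n, if x.k < 0 then 1 else 0, x.k.natAbs].length -
      (List.ofFn fun v => (x.w v : ℕ)).length = u * x.n + v := by
    simp; omega
  rw [e, List.getElem?_eq_getElem (by simpa using hlt)]
  have h1 : Fin.divNat (⟨u * x.n + v, hlt⟩ : Fin (x.n * x.n)) = u := by
    ext
    simp [Fin.divNat, Nat.add_div_of_dvd_right, hpos]
  have h2 : Fin.modNat (⟨u * x.n + v, hlt⟩ : Fin (x.n * x.n)) = v := by
    ext
    simp [Fin.modNat, Nat.mod_eq_of_lt v.2]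
  simp [h1, h2]

theorem adjOf_ne_zero {u v : Fin x.n} : adjOf x.input u v ≠ 0 ↔ x.G.Adj u v := by
  classical
  rw [input_adj]
  split <;> simp_all

theorem agree_iff {u v : Fin x.n} : Agree x.input u v (x.input 0) ↔ Twins x.G u v := by
  rw [twins_iff, Agree, input_zero]
  have key : ∀ z : Fin x.n, adjOf x.input u z = adjOf x.input v z ↔
      (x.G.Adj u z ↔ x.G.Adj v z) := fun z => by
    rw [input_adj, input_adj]
    split <;> split <;> simp_all
  constructor
  · intro h z hu hv
    exact (key z).1 (h z z.2 (Fin.val_ne_of_ne hu) (Fin.val_ne_of_ne hv))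
  · intro h z hz hu hv
    exact (key ⟨z, hz⟩).2 (h ⟨z, hz⟩ (by rintro rfl; exact hu rfl) (by rintro rfl; exact hv rfl))

theorem within_iff {S : Set (Fin x.n)} {s : ℕ → ℕ} (hs : ∀ v : Fin x.n, s v = 0 ↔ v ∉ S)
    {v y : Fin x.n} :
    (∃ i, Within x.input s v i y) ↔ v ∉ S ∧ ReachAvoiding x.G S v y := by
  constructor
  · rintro ⟨i, h⟩
    induction i generalizing y with
    | zero =>
      obtain ⟨h, h'⟩ := h
      obtain rfl := Fin.ext h
      exact ⟨(hs y).1 h', .refl⟩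
    | succ i ih =>
      rcases h with h | ⟨a, ha, h, hadj, hy⟩
      · exact ih h
      · rw [input_zero] at ha
        obtain ⟨hv, h⟩ := ih (y := ⟨a, ha⟩) h
        exact ⟨hv, h.tail ⟨x.adjOf_ne_zero.1 hadj, (hs y).1 hy⟩⟩
  · rintro ⟨hv, h⟩
    induction h with
    | refl => exact ⟨0, rfl, (hs v).2 hv⟩
    | @tail a b _ hab ih =>
      obtain ⟨i, hi⟩ := ih
      exact ⟨i + 1, .inr ⟨a, by rw [input_zero]; exact a.2, hi, x.adjOf_ne_zero.2 hab.1,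
        (hs b).2 hab.2⟩⟩

-- For `v ∈ S` the search finds nothing and the load is just the weight of `S`. This supplies the
-- bound needed when `S` contains all vertices.
open Classical in
theorem loadOf_eq {S : Set (Fin x.n)} {s : ℕ → ℕ}
    (hs : ∀ v : Fin x.n, s v = if v ∈ S then 1 else 0) (v : Fin x.n) :
    loadOf x.input s v = weightOf x.w S +
      if v ∈ S then 0 else weightOf x.w {b | ReachAvoiding x.G S v b} := by
  have hs' : ∀ v : Fin x.n, s v = 0 ↔ v ∉ S := fun v => by rw [hs]; split <;> simp_all
  have : (if v ∈ S then 0 else weightOf x.w {b | ReachAvoiding x.G S v b}) =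
      weightOf x.w {b | v ∉ S ∧ ReachAvoiding x.G S v b} := by
    split
    · simp_all [weightOf]
    · simp_all
  rw [this, loadOf, input_zero, Finset.sum_range, weightOf_eq, weightOf_eq,
    ← Finset.sum_add_distrib]
  refine Finset.sum_congr rfl fun y _ => ?_
  rw [input_weight, hs, add_mul, add_comm]
  congr 1
  · split <;> simp
  · have : _ ↔ y ∈ {b | v ∉ S ∧ ReachAvoiding x.G S v b} := x.within_iff hs'
    by_cases h : ∃ i, Within x.input s v i y
    · rw [if_pos h, if_pos (this.1 h), one_mul]
    · rw [if_neg h, if_neg (fun h' => h (this.2 h')), zero_mul]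

theorem cost_le_iff_loadOf {S : Set (Fin x.n)} {s : ℕ → ℕ}
    (hs : ∀ v : Fin x.n, (v ∈ S → s v = 1) ∧ (v ∉ S → s v = 0)) {k : ℕ} :
    cost x.G x.w S ≤ k ↔ ∀ v < x.n, loadOf x.input s v ≤ k := by
  classical
  have hload := x.loadOf_eq (S := S) (s := s) fun v => by
    split
    · exact (hs v).1 ‹_›
    · exact (hs v).2 ‹_›
  rw [cost_le_iff]
  constructor
  · rintro ⟨h, h'⟩ v hv
    rw [hload ⟨v, hv⟩]
    split
    · simpa using h
    · exact h' _ ‹_›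
  · refine fun h => ⟨?_, fun a ha => ?_⟩
    · by_cases hn : x.n = 0
      · have : IsEmpty (Fin x.n) := by rw [hn]; infer_instance
        simp [weightOf]
      · have := h 0 (by omega)
        rw [hload ⟨0, by omega⟩] at this
        omega
    · have := h a a.2
      rwa [hload a, if_neg ha] at this

theorem classes_card {P : ℕ → ℕ} {m : ℕ} (h : Classes x.input P (x.input 0) m) :
    m = x.ndParam := by
  obtain ⟨c, h1, h2, h3⟩ := h
  rw [input_zero] at h1 h3
  have h2' : ∀ u v : Fin x.n, c u = c v ↔ Twins x.G u v := fun u v => by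
    rw [h2 u (by rw [input_zero]; exact u.2) v (by rw [input_zero]; exact v.2), agree_iff]
  rw [ndParam, nd_eq]
  let f : Quotient (twinSetoid x.G) → Fin m :=
    Quotient.lift (fun v : Fin x.n => (⟨c v, (h1 v v.2).2⟩ : Fin m))
      fun u v huv => Fin.ext ((h2' u v).2 huv)
  have hf : Function.Bijective f := by
    constructor
    · intro a b
      induction a using Quotient.ind
      induction b using Quotient.ind
      intro h
      exact Quotient.sound ((h2' _ _).1 (congrArg Fin.val h))
    · intro i
      obtain ⟨u, hu, he⟩ := h3 i i.2
      exact ⟨Quotient.mk _ ⟨u, hu⟩, Fin.ext he⟩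
  rw [Nat.card_eq_of_bijective f hf, Nat.card_fin]

/-- Any accepted mask describes a set witnessing `wvi ≤ k`. Conversely an optimal irredundant set is
a union of classes, hence described by some mask. -/
theorem isYes_iff {P : ℕ → ℕ} {m : ℕ} (h : Classes x.input P (x.input 0) m) :
    ((∃ s < 2 ^ m, ∀ v < x.input 0, loadOf x.input (selected P s) v ≤ x.input 2) ∧
      x.input 1 = 0) ↔ x.IsYes := by
  classical
  obtain ⟨c, h1, h2, -⟩ := h
  have h2' : ∀ u v : Fin x.n, c u = c v ↔ Twins x.G u v := fun u v => by
    rw [h2 u (by rw [input_zero]; exact u.2) v (by rw [input_zero]; exact v.2), agree_iff]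
  rw [input_zero] at h1
  rw [input_zero, input_one, input_two, IsYes]
  constructor
  · rintro ⟨⟨s, -, hs⟩, hk⟩
    have hk : 0 ≤ x.k := by by_contra h; simp [not_le.1 h] at hk
    have := (x.cost_le_iff_loadOf (S := {v | selected P s v = 1}) (s := selected P s)
      fun v => ⟨id, fun hv => (Nat.mod_two_eq_zero_or_one _).resolve_right hv⟩).2 hs
    have := (wvi_le x.G x.w _).trans this
    omega
  · intro hk
    refine ⟨?_, if_neg (by omega)⟩
    obtain ⟨S, hS, hirr⟩ := exists_isWviSet_isIrredundant x.G x.w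
    have hresp := respectsTwinClasses_iff.1 hirr.respectsTwinClasses
    have hcost : cost x.G x.w S ≤ x.k.natAbs := by
      have := isWviSet_iff.1 hS
      omega
    -- Bit `i` of the mask is set when class `i` meets `S`; since `S` respects twin classes, the
    -- class then lies inside `S`.
    let g : Fin m → Bool := fun i => decide (∃ u ∈ S, c u = i)
    refine ⟨Nat.ofBits g, Nat.ofBits_lt_two_pow g, (x.cost_le_iff_loadOf (S := S) ?_).1 hcost⟩
    intro v
    obtain ⟨hP, hcv⟩ := h1 v v.2
    have hsel : selected P (Nat.ofBits g) v = (g ⟨c v, hcv⟩).toNat := by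
      rw [selected, hP, ← Nat.toNat_testBit, Nat.testBit_ofBits_lt g _ hcv]
    rw [hsel]
    constructor
    · intro hv
      have : g ⟨c v, hcv⟩ = true := decide_eq_true ⟨v, hv, rfl⟩
      rw [this]; rfl
    · intro hv
      have : g ⟨c v, hcv⟩ = false := by
        refine decide_eq_false ?_
        rintro ⟨u, hu, he⟩
        exact hv (hresp u v ((h2' u v).1 he) hu)
      rw [this]; rfl

theorem n_add_three_le : x.n + 3 ≤ inputSize x.encode := by
  refine le_trans ?_ (length_le_inputSize _)
  simp [encode]

/-- With `L` the input size, the weights and `n` are below `2 ^ L`, so twice the total weight is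
below `2 ^ (2 * L + 1)`, and cells of `3 * L` digits suffice. -/
theorem decideIntegrity_reaches :
    Reaches (3 * inputSize x.encode)
      (2 ^ x.ndParam * (8000 * (3 * inputSize x.encode) ^ 5)) .decideIntegrity
      (initStore x.encode) (fun τ => IsBit (τ 1 0) x.IsYes) := by
  have hn := x.n_add_three_le
  have hb := initStore_bdd x.encode
  refine RAM.decideIntegrity_reaches ?_ ?_ (by simp [initStore]) ?_ ?_
    (fun P m' h => x.classes_card h) (fun P h => x.isYes_iff h)
    (fun S v _ y hy i h => h.of_any hy)
  · exact fun a i => (hb a i).trans_le (Nat.pow_le_pow_right (by norm_num) (by omega))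
  · have := x.input_zero
    simp only [input] at this
    omega
  · calc _ ≤ 2 * ∑ y ∈ Finset.range (x.input 0), 2 ^ inputSize x.encode := by
          gcongr with y
          exact (hb 0 _).le
      _ = 2 * (x.n * 2 ^ inputSize x.encode) := by
          rw [Finset.sum_const, Finset.card_range, smul_eq_mul, input_zero]
      _ < 2 * (2 ^ inputSize x.encode * 2 ^ inputSize x.encode) := by
          have : x.n < 2 ^ inputSize x.encode :=
            lt_of_lt_of_le (by omega : x.n < inputSize x.encode) Nat.lt_two_pow_self.le
          gcongr
      _ = 2 ^ (1 + (inputSize x.encode + inputSize x.encode)) := by ring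
      _ ≤ _ := Nat.pow_le_pow_right (by norm_num) (by omega)
  · intro u hu v hv w hw h h'
    have e : initStore x.encode 0 0 = x.n := x.input_zero
    rw [e] at hu hv hw
    exact (x.agree_iff (u := ⟨u, hu⟩) (v := ⟨w, hw⟩)).2
      (((x.agree_iff (u := ⟨u, hu⟩) (v := ⟨v, hv⟩)).1 h).trans
        ((x.agree_iff (u := ⟨v, hv⟩) (v := ⟨w, hw⟩)).1 h'))

end Instance

theorem computable_mul_two_pow (C : ℕ) : Computable fun m : ℕ => C * 2 ^ m := by
  have h : Primrec fun m : ℕ => Nat.rec (motive := fun _ => ℕ) C (fun _ y => 2 * y) m :=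
    Primrec.nat_rec₁ C (Primrec.nat_mul.comp (Primrec.const 2) Primrec.snd)
  refine (h.of_eq fun m => ?_).to_comp
  induction m with
  | zero => simp
  | succ m ih => rw [pow_succ, ← mul_assoc, ← ih, mul_comm]

theorem isFPT_ndParam : IsFPT Instance.encode Instance.ndParam Instance.IsYes := by
  refine ⟨.decideIntegrity, fun m => (8000 * 3 ^ 5) * 2 ^ m, 5, computable_mul_two_pow _,
    fun x => ?_⟩
  obtain ⟨τ, t, hr, ht, -, h1, h2⟩ := x.decideIntegrity_reaches
  refine ⟨τ, t, hr, ht.trans_eq (by ring), fun h => ?_, fun h => ?_⟩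
  · have := h2.2 h
    omega
  · by_contra h'
    exact h (h2.1 h')

end VertexIntegrity

theorem mainTheorem9 :
    RAM.IsFPT VertexIntegrity.Instance.encode VertexIntegrity.Instance.ndParam
        VertexIntegrity.Instance.IsYes ∧
      ∀ (V : Type*) [Fintype V] (G : SimpleGraph V) (w : V → ℕ+),
        (∃ S : Set V, VertexIntegrity.IsWviSet G w S ∧ VertexIntegrity.IsIrredundant G S ∧
          VertexIntegrity.RespectsTwinClasses G S) ∧
        {S : Set V | VertexIntegrity.RespectsTwinClasses G S}.ncard =
          2 ^ VertexIntegrity.nd G := by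
  refine ⟨VertexIntegrity.isFPT_ndParam, fun V _ G w => ⟨?_, ?_⟩⟩
  · obtain ⟨S, hS, hirr⟩ := VertexIntegrity.exists_isWviSet_isIrredundant G w
    exact ⟨S, hS, hirr, hirr.respectsTwinClasses⟩
  · exact VertexIntegrity.ncard_respectsTwinClasses G
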